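/- Let $(f(p))_{p\ \mathrm{prime}}$ be independent random variables, each uniformly distributed on the unit circle $\{z\in\mathbb{C}:|z|=1\}$, and let $f(n)=\prod_{p\mid n} f(p)^{v_p(n)}$ for $n\ge 1$, where $v_p(n)$ is the exponent of $p$ in $n$ (so $f$ is a Steinhaus random multiplicative function). Write $e(x)=e^{2\pi i x}$ and let $P(n)$ denote the largest prime factor of $n$. There is an absolute constant $C>0$ such that for every $\varepsilon>0$, with probability $1-o_\varepsilon(1)$ as $N\to\infty$, $$\max_{\theta\in[0,1]}\frac{1}{\sqrt N}\Bigl|\sum_{\substack{n\le N\\ P(n)\ge N^{0.8}}} f(n)\,e(n\theta)\Bigr|\le C(\log N)^{7/4+\varepsilon}.$$ Here $o_\varepsilon(1)$ denotes a function of $N$ that depends only on $\varepsilon$ and tends to $0$ as $N\to\infty$. -/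

import Mathlib

open MeasureTheory ProbabilityTheory

noncomputable section

namespace RandomMult

/-- The additive character `e(x) = exp(2 π i x)`. -/
def e (x : ℝ) : ℂ := Complex.exp (2 * Real.pi * Complex.I * x)

/-- The uniform probability distribution on the unit circle of `ℂ`: the law of `e(U)` for
`U` uniform on `[0, 1]`. -/
def uniformCircle : Measure ℂ := (volume.restrict (Set.Icc (0 : ℝ) 1)).map e

/-- The largest prime factor of `n`, for `n ≥ 2`; the value is `0` at `n = 0` and `n = 1`. -/
def largestPrimeFactor (n : ℕ) : ℕ := n.primeFactors.sup id

/-- `f` is a Steinhaus random multiplicative function on the probability space `(Ω, μ)`: the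
values at the primes are independent and uniform on the unit circle, and `f` is extended to the
positive integers by `f(n) = ∏_{p ∣ n} f(p) ^ v_p(n)`. -/
structure IsSteinhaus {Ω : Type*} [MeasurableSpace Ω] (μ : Measure Ω) (f : ℕ → Ω → ℂ) :
    Prop where
  measurable_prime : ∀ p : Nat.Primes, Measurable (f p)
  law_prime : ∀ p : Nat.Primes, μ.map (f p) = uniformCircle
  indep_prime : iIndepFun (fun p : Nat.Primes => f p) μ
  eq_prod : ∀ n : ℕ, n ≠ 0 → ∀ ω : Ω, f n ω = ∏ p ∈ n.primeFactors, f p ω ^ padicValNat p n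

/-- The sum of `a(n) e(n θ)` over the `n ≤ N` with largest prime factor at least `N ^ 0.8`. -/
def partialSum (a : ℕ → ℂ) (N : ℕ) (θ : ℝ) : ℂ :=
  ∑ n ∈ Finset.Icc 1 N with (N : ℝ) ^ (0.8 : ℝ) ≤ (largestPrimeFactor n : ℝ), a n * e (n * θ)

/-- The maximum over `θ ∈ [0, 1]` of `N ^ (-1/2) |partialSum a N θ|`. -/
def maxPartialSum (a : ℕ → ℂ) (N : ℕ) : ℝ :=
  ⨆ θ : Set.Icc (0 : ℝ) 1, 1 / Real.sqrt N * ‖partialSum a N θ‖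

/-- The supremum in `maxPartialSum` is attained, so it is a maximum. -/
theorem isGreatest_maxPartialSum (a : ℕ → ℂ) (N : ℕ) :
    IsGreatest ((fun θ : ℝ => 1 / Real.sqrt N * ‖partialSum a N θ‖) '' Set.Icc 0 1)
      (maxPartialSum a N) := by
  have hc : Continuous (fun θ : ℝ => 1 / Real.sqrt N * ‖partialSum a N θ‖) := by
    unfold partialSum e
    fun_prop
  have h := (isCompact_Icc.image hc).isGreatest_sSup
    ((Set.nonempty_Icc.2 (zero_le_one' ℝ)).image _)
  rwa [sSup_image'] at h

end RandomMult

end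

namespace RandomMult

/-! ### The additive character -/

/-! Put `T = ⌈N ^ 0.8⌉` and `R = N / T ≤ N ^ 0.2`. Each `n` in the sum is uniquely `p * m` with `p ≥
T` prime and `m ≤ R < T` (`IsSteinhaus.partialSum_eq`), so the sum is `∑ f(p) c_p(θ)`, where `c_p(θ)
= ∑_{m ≤ N / p} f(m) e(p m θ)` depends only on the primes below `T`. Conditionally on those primes
it is a sum of independent bounded terms. Hoeffding's inequality therefore controls it once the
variance `∑ |c_p(θ)|²` is controlled at all points of a grid with at most `N ^ 4` points; a
Bernstein inequality passes from the grid to all `θ`.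

For the variance, primality of `p` is dropped and the square is opened, which leaves geometric sums
over `n` with frequency `(m₁ - m₂) θ`. By Dirichlet's theorem `θ` may be taken as `a / q + j / (16
N)` with `q ≤ 4 R`. The diagonal contributes about `N log N`, and the pairs with `q ∤ m₁ - m₂`
contribute at most `R² q ≤ N`. For the remaining pairs the kernel does not depend on `a`, so only
the pairs `(q, j)` matter.

These remaining terms are bounded in mean square. Orthogonality of `f` leaves the quadruples with
`m₁ m₄ = m₂ m₃`, and the second moments summed over all `(q, j)` are still only `O(N² (log N)^5)`
(`sum_sum_modKernelBound_le`). Chebyshev's inequality with a union bound makes the variance at most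
`2 N (log N) ^ (5/2 + ε)` on the whole grid simultaneously. The union bound in Hoeffding's
inequality costs one more logarithm in the square, and `(5/2 + 1) / 2 = 7/4`. -/

theorem e_add (x y : ℝ) : e (x + y) = e x * e y := by
  unfold e
  rw [← Complex.exp_add]
  push_cast
  ring_nf

theorem e_zero : e 0 = 1 := by simp [e]

theorem e_intCast (k : ℤ) : e k = 1 := by
  unfold e
  rw [Complex.exp_eq_one_iff]
  exact ⟨k, by push_cast; ring⟩

theorem norm_e (x : ℝ) : ‖e x‖ = 1 := by
  unfold e
  rw [show (2 * Real.pi * Complex.I * x : ℂ) = ((2 * Real.pi * x : ℝ) : ℂ) * Complex.I by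
    push_cast; ring]
  exact Complex.norm_exp_ofReal_mul_I _

theorem conj_e (x : ℝ) : (starRingEnd ℂ) (e x) = e (-x) := by
  unfold e
  rw [← Complex.exp_conj]
  congr 1
  simp [Complex.conj_ofReal, Complex.conj_ofNat]

theorem e_nat_mul (n : ℕ) (x : ℝ) : e (n * x) = e x ^ n := by
  unfold e
  rw [← Complex.exp_nat_mul]
  push_cast
  ring_nf

@[fun_prop]
theorem continuous_e : Continuous e := by
  unfold e
  fun_prop

theorem e_add_intCast (x : ℝ) (k : ℤ) : e (x + k) = e x := by
  rw [e_add, e_intCast, mul_one]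

theorem integral_e_intCast_mul (k : ℤ) : ∫ t in (0 : ℝ)..1, e (k * t) = if k = 0 then 1 else 0 := by
  split_ifs with h
  · simp [h, e_zero]
  · have hc : (2 * Real.pi * Complex.I * k : ℂ) ≠ 0 := by
      simp [Complex.I_ne_zero, Real.pi_ne_zero, h]
    have : ∀ t : ℝ, e (k * t) = Complex.exp ((2 * Real.pi * Complex.I * k) * t) := by
      intro t
      unfold e
      push_cast
      ring_nf
    simp only [this]
    rw [integral_exp_mul_complex hc]
    have h1 : Complex.exp (2 * Real.pi * Complex.I * k * (1 : ℝ)) = 1 := by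
      rw [Complex.exp_eq_one_iff]
      exact ⟨k, by push_cast; ring⟩
    rw [h1]
    simp

/-- The chord is `2 |sin (π x)|`, and Jordan's inequality bounds the sine below. -/
theorem four_mul_abs_le_norm_e_sub_one {x : ℝ} (hx : |x| ≤ 1 / 2) : 4 * |x| ≤ ‖e x - 1‖ := by
  have h0 : e x = Complex.exp (Complex.I * ((2 * Real.pi * x : ℝ) : ℂ)) := by
    unfold e
    push_cast
    ring_nf
  rw [h0, Complex.norm_exp_I_mul_ofReal_sub_one, Real.norm_eq_abs, abs_mul,
    show (2 * Real.pi * x / 2) = Real.pi * x by ring]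
  have key : 2 * |x| ≤ |Real.sin (Real.pi * x)| := by
    have h1 : |Real.sin (Real.pi * x)| = |Real.sin (Real.pi * |x|)| := by
      rcases abs_choice x with h | h <;> rw [h]
      rw [mul_neg, Real.sin_neg, abs_neg]
    have h2 := Real.mul_le_sin (x := Real.pi * |x|) (by positivity)
      (by nlinarith [Real.pi_pos])
    have h3 : 2 / Real.pi * (Real.pi * |x|) = 2 * |x| := by
      field_simp
    rw [h1]
    exact (h3 ▸ h2).trans (le_abs_self _)
  rw [abs_two]
  linarith

theorem norm_sum_e_mul_le (T M : ℕ) (x : ℝ) :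
    ‖∑ n ∈ Finset.Icc T M, e (n * x)‖ * ‖e x - 1‖ ≤ 2 := by
  rw [← norm_mul]
  simp only [e_nat_mul]
  rcases le_or_gt T (M + 1) with h | h
  · rw [show Finset.Icc T M = Finset.Ico T (M + 1) by ext; simp, geom_sum_Ico_mul _ h]
    refine (norm_sub_le _ _).trans ?_
    simp only [norm_pow, norm_e, one_pow]
    norm_num
  · rw [Finset.Icc_eq_empty (by omega)]
    simp

theorem norm_sum_e_mul_le_inv {T M : ℕ} {x : ℝ} (hx : |x| ≤ 1 / 2) (h0 : x ≠ 0) :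
    ‖∑ n ∈ Finset.Icc T M, e (n * x)‖ ≤ 1 / (2 * |x|) := by
  have h1 := norm_sum_e_mul_le T M x
  have h2 := four_mul_abs_le_norm_e_sub_one hx
  have h3 : 0 < |x| := abs_pos.2 h0
  rw [le_div_iff₀ (by positivity)]
  nlinarith [mul_le_mul_of_nonneg_left h2 (norm_nonneg (∑ n ∈ Finset.Icc T M, e (n * x)))]

theorem norm_sum_e_mul_le_card {T : ℕ} (hT : 1 ≤ T) (M : ℕ) (x : ℝ) :
    ‖∑ n ∈ Finset.Icc T M, e (n * x)‖ ≤ M := by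
  refine (norm_sum_le _ _).trans ?_
  simp only [norm_e, Finset.sum_const, Nat.card_Icc, nsmul_eq_mul, mul_one]
  exact_mod_cast (by omega : M + 1 - T ≤ M)

theorem norm_sum_e_mul_le_of_sub_intCast {T M : ℕ} {x δ : ℝ} (hδ : 0 < δ)
    (h : ∀ k : ℤ, δ ≤ |x - k|) : ‖∑ n ∈ Finset.Icc T M, e (n * x)‖ ≤ 1 / (2 * δ) := by
  have h1 := norm_sum_e_mul_le T M x
  have h2 := four_mul_abs_le_norm_e_sub_one (abs_sub_round x)
  rw [show x - round x = x + ((-round x : ℤ) : ℝ) by push_cast; ring, e_add_intCast] at h2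
  have h3 := h (round x)
  rw [show x - round x = x + ((-round x : ℤ) : ℝ) by push_cast; ring] at h3
  rw [le_div_iff₀ (by positivity)]
  nlinarith [mul_le_mul_of_nonneg_left (h3.trans (by linarith : _ ≤ ‖e x - 1‖ / 4))
    (norm_nonneg (∑ n ∈ Finset.Icc T M, e (n * x)))]

/-! ### A Bernstein inequality for trigonometric polynomials -/

theorem sum_range_e_mul_conj (N : ℕ) (t : ℝ) :
    ((‖∑ x ∈ Finset.range N, e (x * t)‖ ^ 2 : ℝ) : ℂ) =
      ∑ x ∈ Finset.range N, ∑ y ∈ Finset.range N, e (((x : ℤ) - y : ℤ) * t) := by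
  rw [Complex.ofReal_pow, ← Complex.mul_conj', map_sum, Finset.sum_mul_sum]
  refine Finset.sum_congr rfl fun x _ => Finset.sum_congr rfl fun y _ => ?_
  rw [conj_e, ← e_add]
  push_cast
  ring_nf

/-- The squared norm is an unnormalized Fejér kernel. Its `n`-th Fourier coefficient counts the
pairs `x - y = n` in `[0, N)`, of which there are `N - n`. -/
theorem integral_e_mul_fejer (N n : ℕ) (hn : n ≤ N) (θ : ℝ) :
    ∫ t in (0 : ℝ)..1, e (n * (θ - t)) * ((‖∑ x ∈ Finset.range N, e (x * t)‖ ^ 2 : ℝ) : ℂ) =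
      ((N : ℂ) - n) * e (n * θ) := by
  have h1 : ∀ t : ℝ, e (n * (θ - t)) * ((‖∑ x ∈ Finset.range N, e (x * t)‖ ^ 2 : ℝ) : ℂ) =
      ∑ x ∈ Finset.range N, ∑ y ∈ Finset.range N, e (n * θ) * e (((x : ℤ) - y - n : ℤ) * t) := by
    intro t
    rw [sum_range_e_mul_conj, Finset.mul_sum]
    refine Finset.sum_congr rfl fun x _ => ?_
    rw [Finset.mul_sum]
    refine Finset.sum_congr rfl fun y _ => ?_
    rw [← e_add, ← e_add]
    push_cast
    ring_nf
  simp only [h1]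
  rw [intervalIntegral.integral_finsetSum fun x _ => by
    apply Continuous.intervalIntegrable; fun_prop]
  have h2 : ∀ x ∈ Finset.range N, ∫ t in (0 : ℝ)..1, ∑ y ∈ Finset.range N,
      e (n * θ) * e (((x : ℤ) - y - n : ℤ) * t) = if n ≤ x then e (n * θ) else 0 := by
    intro x hx
    rw [intervalIntegral.integral_finsetSum fun y _ => by
      apply Continuous.intervalIntegrable; fun_prop]
    simp only [intervalIntegral.integral_const_mul, integral_e_intCast_mul, mul_ite, mul_one,
      mul_zero]
    split_ifs with h
    · rw [Finset.sum_eq_single (x - n)]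
      · rw [if_pos]
        omega
      · intro y _ hy
        rw [if_neg]
        omega
      · intro hy
        simp at hy hx
        omega
    · refine Finset.sum_eq_zero fun y _ => if_neg ?_
      omega
  rw [Finset.sum_congr rfl h2, ← Finset.sum_filter, Finset.sum_const,
    show (Finset.range N).filter (fun x => n ≤ x) = Finset.Ico n N by ext; simp; omega,
    Nat.card_Ico, nsmul_eq_mul, Nat.cast_sub hn]

/-- The weighted sum is the convolution of the polynomial with a nonnegative kernel of total mass
`N`. Writing `n = N - (N - n)` then bounds the derivative in Bernstein's inequality. -/
theorem norm_sum_fejer_le {N : ℕ} {s : Finset ℕ} (hs : ∀ n ∈ s, n ≤ N) (a : ℕ → ℂ) {M : ℝ}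
    (hM : ∀ θ : ℝ, ‖∑ n ∈ s, a n * e (n * θ)‖ ≤ M) (θ : ℝ) :
    ‖∑ n ∈ s, ((N : ℂ) - n) * (a n * e (n * θ))‖ ≤ N * M := by
  have hM0 : 0 ≤ M := (norm_nonneg _).trans (hM 0)
  have h1 : ∑ n ∈ s, ((N : ℂ) - n) * (a n * e (n * θ)) =
      ∫ t in (0 : ℝ)..1, (∑ n ∈ s, a n * e (n * (θ - t))) *
        ((‖∑ x ∈ Finset.range N, e (x * t)‖ ^ 2 : ℝ) : ℂ) := by
    simp only [Finset.sum_mul]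
    rw [intervalIntegral.integral_finsetSum fun x _ => by
      apply Continuous.intervalIntegrable; fun_prop]
    refine Finset.sum_congr rfl fun n hn => ?_
    simp only [mul_assoc]
    rw [intervalIntegral.integral_const_mul, integral_e_mul_fejer N n (hs n hn)]
    ring
  have h2 : ∫ t in (0 : ℝ)..1, ‖∑ x ∈ Finset.range N, e (x * t)‖ ^ 2 = N := by
    have := integral_e_mul_fejer N 0 (Nat.zero_le _) 0
    simp only [Nat.cast_zero, zero_mul, e_zero, one_mul, sub_zero, mul_one] at this
    rw [intervalIntegral.integral_ofReal] at this
    exact_mod_cast this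
  rw [h1]
  refine (intervalIntegral.norm_integral_le_integral_norm zero_le_one).trans ?_
  calc _ ≤ ∫ t in (0 : ℝ)..1, M * ‖∑ x ∈ Finset.range N, e (x * t)‖ ^ 2 := by
        apply intervalIntegral.integral_mono_on zero_le_one
        · apply Continuous.intervalIntegrable; fun_prop
        · apply Continuous.intervalIntegrable; fun_prop
        · intro t _
          rw [norm_mul, Complex.norm_real, norm_pow, norm_norm]
          exact mul_le_mul_of_nonneg_right (hM _) (by positivity)
    _ = N * M := by rw [intervalIntegral.integral_const_mul, h2, mul_comm]

theorem hasDerivAt_sum_mul_e (s : Finset ℕ) (a : ℕ → ℂ) (θ : ℝ) :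
    HasDerivAt (fun θ : ℝ => ∑ n ∈ s, a n * e (n * θ))
      (2 * Real.pi * Complex.I * ∑ n ∈ s, (n : ℂ) * (a n * e (n * θ))) θ := by
  rw [Finset.mul_sum]
  refine HasDerivAt.fun_sum fun n _ => ?_
  have h : HasDerivAt (fun θ : ℝ => (2 * Real.pi * Complex.I * ((n * θ : ℝ) : ℂ) : ℂ))
      (2 * Real.pi * Complex.I * ((n : ℝ) : ℂ)) θ := by
    have h1 : HasDerivAt (fun θ : ℝ => (n : ℝ) * θ) n θ := by
      simpa using (hasDerivAt_id θ).const_mul (n : ℝ)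
    exact (h1.ofReal_comp).const_mul _
  refine ((h.cexp).const_mul (a n)).congr_deriv ?_
  simp only [e]
  push_cast
  ring

/-- A weak form of **Bernstein's inequality** for trigonometric polynomials of degree `N`. -/
theorem norm_sum_sub_sum_le {N : ℕ} {s : Finset ℕ} (hs : ∀ n ∈ s, n ≤ N) (a : ℕ → ℂ) {M : ℝ}
    (hM : ∀ θ : ℝ, ‖∑ n ∈ s, a n * e (n * θ)‖ ≤ M) (θ θ' : ℝ) :
    ‖∑ n ∈ s, a n * e (n * θ) - ∑ n ∈ s, a n * e (n * θ')‖ ≤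
      4 * Real.pi * N * M * |θ - θ'| := by
  have hd : ∀ x : ℝ, ‖2 * Real.pi * Complex.I * ∑ n ∈ s, (n : ℂ) * (a n * e (n * x))‖ ≤
      4 * Real.pi * N * M := by
    intro x
    have h1 : ∑ n ∈ s, (n : ℂ) * (a n * e (n * x)) = N * ∑ n ∈ s, a n * e (n * x) -
        ∑ n ∈ s, ((N : ℂ) - n) * (a n * e (n * x)) := by
      rw [Finset.mul_sum, ← Finset.sum_sub_distrib]
      exact Finset.sum_congr rfl fun n _ => by ring
    have h2 : ‖∑ n ∈ s, (n : ℂ) * (a n * e (n * x))‖ ≤ N * M + N * M := by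
      rw [h1]
      refine (norm_sub_le _ _).trans (add_le_add ?_ (norm_sum_fejer_le hs a hM x))
      rw [norm_mul, Complex.norm_natCast]
      exact mul_le_mul_of_nonneg_left (hM x) (Nat.cast_nonneg _)
    rw [norm_mul, norm_mul, norm_mul, Complex.norm_I, Complex.norm_real, Complex.norm_two,
      Real.norm_of_nonneg Real.pi_pos.le]
    nlinarith [Real.pi_pos]
  have := Convex.norm_image_sub_le_of_norm_hasDerivWithin_le (s := Set.univ)
    (fun x _ => (hasDerivAt_sum_mul_e s a x).hasDerivWithinAt) (fun x _ => hd x) convex_univ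
    (Set.mem_univ θ') (Set.mem_univ θ)
  rwa [Real.norm_eq_abs] at this

/-- Take `θ₀` where the norm is maximal, say `M`. Within `1 / (32 N)` of it the polynomial changes
by at most `4 π N M / (32 N) = π M / 8 ≤ M / 2`, so any sample point that close sees half of the
maximum. -/
theorem exists_forall_norm_le_two_mul {N : ℕ} {s : Finset ℕ} (hs : ∀ n ∈ s, n ≤ N)
    (a : ℕ → ℂ) : ∃ θ₀ ∈ Set.Icc (0 : ℝ) 1, ∀ θ' : ℝ, |θ' - θ₀| * (32 * N) ≤ 1 →
      ∀ θ : ℝ, ‖∑ n ∈ s, a n * e (n * θ)‖ ≤ 2 * ‖∑ n ∈ s, a n * e (n * θ')‖ := by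
  have hc : Continuous (fun θ : ℝ => ‖∑ n ∈ s, a n * e (n * θ)‖) := by fun_prop
  obtain ⟨θ₀, h0, hmax⟩ := isCompact_Icc.exists_isMaxOn
    (Set.nonempty_Icc.2 (zero_le_one' ℝ)) hc.continuousOn
  have hmax' : ∀ θ : ℝ, ‖∑ n ∈ s, a n * e (n * θ)‖ ≤ ‖∑ n ∈ s, a n * e (n * θ₀)‖ := by
    intro θ
    have h1 : ∑ n ∈ s, a n * e (n * θ) = ∑ n ∈ s, a n * e (n * Int.fract θ) := by
      refine Finset.sum_congr rfl fun n _ => ?_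
      have : (n : ℝ) * θ = n * Int.fract θ + ((n * ⌊θ⌋ : ℤ) : ℝ) := by
        push_cast
        rw [← mul_add, Int.fract_add_floor]
      rw [this, e_add_intCast]
    rw [h1]
    exact hmax ⟨Int.fract_nonneg θ, (Int.fract_lt_one θ).le⟩
  refine ⟨θ₀, h0, fun θ' hθ' θ => (hmax' θ).trans ?_⟩
  have h2 := norm_sum_sub_sum_le hs a hmax' θ₀ θ'
  have h3 := norm_sub_norm_le (∑ n ∈ s, a n * e (n * θ₀)) (∑ n ∈ s, a n * e (n * θ'))
  set M := ‖∑ n ∈ s, a n * e (n * θ₀)‖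
  have h4 : 4 * Real.pi * N * M * |θ₀ - θ'| ≤ M / 2 := by
    rw [abs_sub_comm]
    have h5 : 4 * Real.pi * N * M * |θ' - θ₀| = (Real.pi / 8 * M) * (|θ' - θ₀| * (32 * N)) := by
      ring
    have h6 : 0 ≤ M := norm_nonneg _
    rw [h5]
    calc _ ≤ (Real.pi / 8 * M) * 1 := by
          apply mul_le_mul_of_nonneg_left hθ'
          have := Real.pi_pos
          positivity
      _ ≤ M / 2 := by nlinarith [Real.pi_le_four]
  linarith

/-! ### Divisor sums -/

theorem sum_le_sum_of_leftInverse {α β : Type*} {s : Finset α} {t : Finset β} (i : α → β)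
    (j : β → α) {F : α → ℝ} {G : β → ℝ} (hi : ∀ x ∈ s, i x ∈ t) (hj : ∀ x ∈ s, j (i x) = x)
    (hFG : ∀ x ∈ s, F x ≤ G (i x)) (hG : ∀ y ∈ t, 0 ≤ G y) :
    ∑ x ∈ s, F x ≤ ∑ y ∈ t, G y := by
  classical
  have hinj : Set.InjOn i s := fun x hx y hy h => by rw [← hj x hx, ← hj y hy, h]
  calc ∑ x ∈ s, F x ≤ ∑ x ∈ s, G (i x) := Finset.sum_le_sum hFG
    _ = ∑ y ∈ s.image i, G y := (Finset.sum_image hinj).symm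
    _ ≤ ∑ y ∈ t, G y := Finset.sum_le_sum_of_subset_of_nonneg
        (Finset.image_subset_iff.2 hi) fun y hy _ => hG y hy

/-- The harmonic sum `∑_{k ≤ R} 1 / k`, as a real number. -/
noncomputable def harmonicSum (R : ℕ) : ℝ := ∑ k ∈ Finset.Icc 1 R, 1 / (k : ℝ)

theorem harmonicSum_nonneg (R : ℕ) : 0 ≤ harmonicSum R :=
  Finset.sum_nonneg fun _ _ => by positivity

theorem harmonicSum_le (R : ℕ) : harmonicSum R ≤ 1 + Real.log R := by
  have := harmonic_le_one_add_log R
  rw [harmonic_eq_sum_Icc] at this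
  push_cast at this
  simpa [harmonicSum] using this

theorem sum_filter_dvd_le {w : ℕ} (hw : 1 ≤ w) (R : ℕ) {φ : ℕ → ℝ} (hφ : ∀ k, 0 ≤ φ k) :
    ∑ k ∈ Finset.Icc 1 R with w ∣ k, φ k ≤ ∑ k ∈ Finset.Icc 1 R, φ (w * k) := by
  refine sum_le_sum_of_leftInverse (fun k => k / w) (fun k => w * k) ?_ ?_ ?_ fun _ _ => hφ _
  · intro k hk
    simp only [Finset.mem_filter, Finset.mem_Icc] at hk ⊢
    exact ⟨Nat.div_pos (Nat.le_of_dvd (by omega) hk.2) hw, (Nat.div_le_self _ _).trans hk.1.2⟩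
  · intro k hk
    exact Nat.mul_div_cancel' (Finset.mem_filter.1 hk).2
  · intro k hk
    rw [Nat.mul_div_cancel' (Finset.mem_filter.1 hk).2]

theorem sum_filter_dvd_inv_le {w : ℕ} (hw : 1 ≤ w) (R : ℕ) :
    ∑ k ∈ Finset.Icc 1 R with w ∣ k, 1 / (k : ℝ) ≤ 1 / w * harmonicSum R := by
  refine (sum_filter_dvd_le hw R fun _ => by positivity).trans (le_of_eq ?_)
  rw [harmonicSum, Finset.mul_sum]
  refine Finset.sum_congr rfl fun k _ => ?_
  push_cast
  rw [one_div_mul_one_div]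

theorem sum_Icc_inv_sq_le_two (Q : ℕ) : ∑ w ∈ Finset.Icc 1 Q, (1 / (w : ℝ)) ^ 2 ≤ 2 := by
  have h := sum_Ioo_inv_sq_le (α := ℝ) 0 (Q + 1)
  rw [show Finset.Icc 1 Q = Finset.Ioo 0 (Q + 1) by ext; simp; omega]
  simpa using h

/-- With `g = gcd(q, D)`, `q ∣ D k` forces `q / g ∣ k`, so the inner sum is at most `(g / q) H`,
where `H = harmonicSum R`. Replacing `g` by a sum over all `u ∣ D` with `u ∣ q` and writing `q = u
w` leaves `∑ 1 / w² ≤ 2` for each divisor `u`. -/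
theorem sum_sq_sum_filter_dvd_mul_le {D : ℕ} (hD : 1 ≤ D) (Q R : ℕ) :
    ∑ q ∈ Finset.Icc 1 Q, (∑ k ∈ Finset.Icc 1 R with q ∣ D * k, 1 / (k : ℝ)) ^ 2 ≤
      2 * harmonicSum R ^ 2 * D.divisors.card := by
  have h1 : ∀ q ∈ Finset.Icc 1 Q, (∑ k ∈ Finset.Icc 1 R with q ∣ D * k, 1 / (k : ℝ)) ^ 2 ≤
      ∑ u ∈ D.divisors, if u ∣ q then harmonicSum R ^ 2 * ((u : ℝ) / q) ^ 2 else 0 := by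
    intro q hq
    have hq1 : 1 ≤ q := (Finset.mem_Icc.1 hq).1
    have hg : 0 < Nat.gcd q D := Nat.gcd_pos_of_pos_left _ hq1
    have hgq : Nat.gcd q D ∣ q := Nat.gcd_dvd_left _ _
    have hq' : 1 ≤ q / Nat.gcd q D := Nat.div_pos (Nat.le_of_dvd hq1 hgq) hg
    have h2 : ∑ k ∈ Finset.Icc 1 R with q ∣ D * k, 1 / (k : ℝ) ≤
        (Nat.gcd q D : ℝ) / q * harmonicSum R := by
      calc _ ≤ ∑ k ∈ Finset.Icc 1 R with q / Nat.gcd q D ∣ k, 1 / (k : ℝ) := by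
            refine Finset.sum_le_sum_of_subset_of_nonneg ?_ fun _ _ _ => by positivity
            refine Finset.monotone_filter_right _ fun k _ hk => ?_
            refine (Nat.coprime_div_gcd_div_gcd hg).dvd_of_dvd_mul_left
              (?_ : q / Nat.gcd q D ∣ D / Nat.gcd q D * k)
            rw [Nat.div_mul_right_comm (Nat.gcd_dvd_right _ _)]
            exact Nat.div_dvd_div hgq hk
        _ ≤ _ := by
            refine (sum_filter_dvd_inv_le hq' R).trans (le_of_eq ?_)
            rw [Nat.cast_div hgq (by positivity), one_div_div]
    calc _ ≤ ((Nat.gcd q D : ℝ) / q * harmonicSum R) ^ 2 :=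
          pow_le_pow_left₀ (Finset.sum_nonneg fun _ _ => by positivity) h2 2
      _ = if Nat.gcd q D ∣ q then harmonicSum R ^ 2 * ((Nat.gcd q D : ℝ) / q) ^ 2 else 0 := by
          rw [if_pos hgq]
          ring
      _ ≤ _ := by
          refine Finset.single_le_sum
            (f := fun u => if u ∣ q then harmonicSum R ^ 2 * ((u : ℝ) / q) ^ 2 else 0)
            (fun u _ => ?_) ?_
          · split_ifs <;> positivity
          · exact Nat.mem_divisors.2 ⟨Nat.gcd_dvd_right _ _, by omega⟩
  refine (Finset.sum_le_sum h1).trans ?_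
  rw [Finset.sum_comm]
  have h3 : ∀ u ∈ D.divisors, (∑ q ∈ Finset.Icc 1 Q,
      if u ∣ q then harmonicSum R ^ 2 * ((u : ℝ) / q) ^ 2 else 0) ≤ 2 * harmonicSum R ^ 2 := by
    intro u hu
    have hu1 : 1 ≤ u := Nat.pos_of_mem_divisors hu
    rw [← Finset.sum_filter]
    refine (sum_filter_dvd_le (φ := fun q => harmonicSum R ^ 2 * ((u : ℝ) / q) ^ 2) hu1 Q
      fun _ => by positivity).trans ?_
    rw [← Finset.mul_sum, mul_comm]
    refine mul_le_mul_of_nonneg_right (le_trans (le_of_eq ?_) (sum_Icc_inv_sq_le_two Q))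
      (by positivity)
    refine Finset.sum_congr rfl fun w _ => ?_
    have hu0 : (u : ℝ) ≠ 0 := by positivity
    push_cast
    rw [div_mul_eq_div_div, div_self hu0]
  refine (Finset.sum_le_sum h3).trans (le_of_eq ?_)
  rw [Finset.sum_const, nsmul_eq_mul]
  ring

theorem sum_card_divisors_div_le (R : ℕ) :
    ∑ D ∈ Finset.Icc 1 R, (D.divisors.card : ℝ) / D ≤ harmonicSum R ^ 2 := by
  have h1 : ∀ D ∈ Finset.Icc 1 R, (D.divisors.card : ℝ) / D =
      ∑ u ∈ Finset.Icc 1 R, if u ∣ D then 1 / (D : ℝ) else 0 := by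
    intro D hD
    rw [Finset.mem_Icc] at hD
    rw [← Finset.sum_filter, Finset.sum_const, nsmul_eq_mul, mul_one_div]
    congr 3
    ext u
    simp only [Nat.mem_divisors, Finset.mem_filter, Finset.mem_Icc]
    constructor
    · rintro ⟨h, h0⟩
      exact ⟨⟨Nat.pos_of_dvd_of_pos h (by omega), (Nat.le_of_dvd (by omega) h).trans hD.2⟩, h⟩
    · rintro ⟨_, h⟩
      exact ⟨h, by omega⟩
  rw [Finset.sum_congr rfl h1, Finset.sum_comm]
  have h2 : ∀ u ∈ Finset.Icc 1 R, (∑ D ∈ Finset.Icc 1 R, if u ∣ D then 1 / (D : ℝ) else 0) ≤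
      1 / u * harmonicSum R := by
    intro u hu
    rw [← Finset.sum_filter]
    exact sum_filter_dvd_inv_le (Finset.mem_Icc.1 hu).1 R
  refine (Finset.sum_le_sum h2).trans (le_of_eq ?_)
  rw [← Finset.sum_mul, sq]
  rfl

/-- The substitution `(a, b) ↦ (a, a - b)` is an involution that separates the factors `1 / max` and
`F D / D`. -/
theorem sum_filter_lt_le (R : ℕ) {F : ℕ → ℝ} (hF : ∀ D, 0 ≤ F D) :
    ∑ x ∈ Finset.Icc 1 R ×ˢ Finset.Icc 1 R with x.2 < x.1,
      F (Nat.dist x.1 x.2) / (max x.1 x.2 * Nat.dist x.1 x.2 : ℕ) ≤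
      harmonicSum R * ∑ D ∈ Finset.Icc 1 R, F D / D := by
  rw [harmonicSum, Finset.sum_mul_sum, ← Finset.sum_product']
  refine sum_le_sum_of_leftInverse (fun x => (x.1, x.1 - x.2)) (fun x => (x.1, x.1 - x.2))
    ?_ ?_ ?_ ?_
  · rintro ⟨a, b⟩ h
    simp only [Finset.mem_filter, Finset.mem_product, Finset.mem_Icc] at h ⊢
    omega
  · rintro ⟨a, b⟩ h
    simp only [Finset.mem_filter, Finset.mem_product, Finset.mem_Icc, Prod.mk.injEq,
      true_and] at h ⊢
    omega
  · rintro ⟨a, b⟩ h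
    simp only [Finset.mem_filter, Finset.mem_product, Finset.mem_Icc] at h ⊢
    rw [Nat.dist_eq_sub_of_le_right h.2.le, max_eq_left h.2.le, one_div_mul_eq_div, div_div,
      Nat.cast_mul, mul_comm (a : ℝ)]
  · intro y _
    have := hF y.2
    positivity

theorem sum_filter_ne_le (R : ℕ) {F : ℕ → ℝ} (hF : ∀ D, 0 ≤ F D) :
    ∑ x ∈ Finset.Icc 1 R ×ˢ Finset.Icc 1 R with x.1 ≠ x.2,
      F (Nat.dist x.1 x.2) / (max x.1 x.2 * Nat.dist x.1 x.2 : ℕ) ≤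
      2 * harmonicSum R * ∑ D ∈ Finset.Icc 1 R, F D / D := by
  have h1 := sum_filter_lt_le R hF
  have h2 : ∑ x ∈ Finset.Icc 1 R ×ˢ Finset.Icc 1 R with x.1 < x.2,
      F (Nat.dist x.1 x.2) / (max x.1 x.2 * Nat.dist x.1 x.2 : ℕ) ≤
      harmonicSum R * ∑ D ∈ Finset.Icc 1 R, F D / D := by
    refine le_trans ?_ h1
    refine sum_le_sum_of_leftInverse Prod.swap Prod.swap ?_ ?_ ?_ ?_
    · rintro ⟨a, b⟩ h
      simp only [Finset.mem_filter, Finset.mem_product, Finset.mem_Icc, Prod.swap] at h ⊢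
      omega
    · rintro ⟨a, b⟩ h
      rfl
    · rintro ⟨a, b⟩ h
      simp only [Prod.swap]
      rw [Nat.dist_comm, max_comm]
    · intro y _
      have := hF (Nat.dist y.1 y.2)
      positivity
  have h3 : ∑ x ∈ Finset.Icc 1 R ×ˢ Finset.Icc 1 R with x.1 ≠ x.2,
      F (Nat.dist x.1 x.2) / (max x.1 x.2 * Nat.dist x.1 x.2 : ℕ) =
      ∑ x ∈ Finset.Icc 1 R ×ˢ Finset.Icc 1 R with x.2 < x.1,
      F (Nat.dist x.1 x.2) / (max x.1 x.2 * Nat.dist x.1 x.2 : ℕ) +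
      ∑ x ∈ Finset.Icc 1 R ×ˢ Finset.Icc 1 R with x.1 < x.2,
      F (Nat.dist x.1 x.2) / (max x.1 x.2 * Nat.dist x.1 x.2 : ℕ) := by
    rw [← Finset.sum_union]
    · congr 1
      ext x
      simp only [Finset.mem_filter, Finset.mem_union]
      constructor
      · rintro ⟨h, h'⟩
        rcases lt_or_gt_of_ne h' with h' | h' <;> simp [h, h']
      · rintro (⟨h, h'⟩ | ⟨h, h'⟩)
        · exact ⟨h, h'.ne'⟩
        · exact ⟨h, h'.ne⟩
    · rw [Finset.disjoint_filter]
      intro x _ h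
      omega
  rw [h3]
  linarith

/-! ### Summation over the offset from a rational point -/

/-- A minimum is at most the harmonic mean, here `2 u v / (v + u j)`, and the squares of these are
dominated by a telescoping difference. -/
theorem sum_Icc_min_sq_le {u v : ℝ} (hu : 0 < u) (hv : 0 < v) (n : ℕ) :
    ∑ j ∈ Finset.Icc 1 n, min u (v / j) ^ 2 ≤ 4 * u * v - 4 * u * v ^ 2 / (v + u * n) := by
  induction n with
  | zero =>
    simp
    field_simp
    simp
  | succ n ih =>
    rw [Finset.sum_Icc_succ_top (by omega)]
    have h1 : min u (v / (n + 1 : ℕ)) ≤ 2 * u * v / (v + u * (n + 1 : ℕ)) := by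
      have hn : (0 : ℝ) < (n + 1 : ℕ) := by positivity
      rcases le_total u (v / (n + 1 : ℕ)) with h | h
      · rw [min_eq_left h, le_div_iff₀ (by positivity)]
        rw [le_div_iff₀ hn] at h
        nlinarith
      · rw [min_eq_right h, div_le_div_iff₀ hn (by positivity)]
        rw [div_le_iff₀ hn] at h
        nlinarith
    have h2 : min u (v / (n + 1 : ℕ)) ^ 2 ≤ (2 * u * v / (v + u * (n + 1 : ℕ))) ^ 2 :=
      pow_le_pow_left₀ (le_min hu.le (by positivity)) h1 2
    have h3 : (2 * u * v / (v + u * (n + 1 : ℕ))) ^ 2 ≤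
        4 * u * v ^ 2 / (v + u * n) - 4 * u * v ^ 2 / (v + u * (n + 1 : ℕ)) := by
      have ha : 0 < v + u * (n : ℝ) := by positivity
      have hb : 0 < v + u * ((n + 1 : ℕ) : ℝ) := by positivity
      have hab : v + u * (n : ℝ) ≤ v + u * ((n + 1 : ℕ) : ℝ) := by
        push_cast
        linarith
      have : 4 * u * v ^ 2 / (v + u * n) - 4 * u * v ^ 2 / (v + u * (n + 1 : ℕ)) =
          (2 * u * v) ^ 2 / ((v + u * n) * (v + u * (n + 1 : ℕ))) := by
        field_simp
        push_cast
        ring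
      rw [this, div_pow]
      apply div_le_div_of_nonneg_left (by positivity) (by positivity)
      nlinarith
    linarith

/-- The bound for the normalized kernel at the pair `(a, b)` and offset `j`. -/
noncomputable def kernelBound (j : ℤ) (a b : ℕ) : ℝ :=
  if j = 0 then 1 / (max a b : ℕ) else
    min (1 / (max a b : ℕ)) (8 / (Nat.dist a b : ℝ) / (j.natAbs : ℝ))

theorem kernelBound_nonneg (j : ℤ) (a b : ℕ) : 0 ≤ kernelBound j a b := by
  unfold kernelBound
  split_ifs <;> positivity

theorem kernelBound_mul (j : ℤ) (a b : ℕ) (k : ℕ) :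
    kernelBound j (a * k) (b * k) = kernelBound j a b / k := by
  unfold kernelBound
  rw [Nat.mul_max_mul_right, Nat.dist_mul_right]
  push_cast
  split_ifs
  · rw [div_mul_eq_div_div]
  · rw [← min_div_div_right (by positivity)]
    congr 1
    · rw [div_mul_eq_div_div]
    · rw [div_mul_eq_div_div, div_right_comm]

theorem sum_kernelBound_sq_le {a b : ℕ} (ha : 1 ≤ a) (hab : a ≠ b) (J : ℕ) :
    ∑ j ∈ Finset.Icc (-J : ℤ) J, kernelBound j a b ^ 2 ≤
      65 / (max a b * Nat.dist a b : ℕ) := by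
  have hA : (1 : ℝ) ≤ (max a b : ℕ) := by exact_mod_cast le_max_of_le_left ha
  have hD' : 1 ≤ Nat.dist a b := Nat.dist_pos_of_ne hab
  have hD : (1 : ℝ) ≤ Nat.dist a b := by exact_mod_cast hD'
  have hDA : (Nat.dist a b : ℝ) ≤ (max a b : ℕ) := by
    have : Nat.dist a b ≤ max a b := by
      unfold Nat.dist
      omega
    exact_mod_cast this
  set u : ℝ := 1 / (max a b : ℕ)
  set v : ℝ := 8 / (Nat.dist a b : ℝ)
  have hu : 0 < u := by positivity
  have hv : 0 < v := by positivity
  have hmain : ∑ j ∈ Finset.Icc 1 J, min u (v / j) ^ 2 ≤ 4 * u * v :=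
    (sum_Icc_min_sq_le hu hv J).trans (sub_le_self _ (by positivity))
  have hpos : ∑ j ∈ Finset.Icc (-J : ℤ) J with 0 < j, kernelBound j a b ^ 2 ≤ 4 * u * v := by
    refine le_trans (sum_le_sum_of_leftInverse Int.natAbs (fun n => (n : ℤ)) ?_ ?_ ?_ ?_) hmain
    · intro j hj
      simp only [Finset.mem_filter, Finset.mem_Icc] at hj ⊢
      omega
    · intro j hj
      simp only [Finset.mem_filter, Finset.mem_Icc] at hj ⊢
      omega
    · intro j hj
      rw [kernelBound, if_neg (Finset.mem_filter.1 hj).2.ne']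
    · intro j _
      positivity
  have hneg : ∑ j ∈ Finset.Icc (-J : ℤ) J with j < 0, kernelBound j a b ^ 2 ≤ 4 * u * v := by
    refine le_trans (sum_le_sum_of_leftInverse Int.natAbs (fun n => -(n : ℤ)) ?_ ?_ ?_ ?_) hmain
    · intro j hj
      simp only [Finset.mem_filter, Finset.mem_Icc] at hj ⊢
      omega
    · intro j hj
      simp only [Finset.mem_filter, Finset.mem_Icc] at hj ⊢
      omega
    · intro j hj
      rw [kernelBound, if_neg (Finset.mem_filter.1 hj).2.ne]
    · intro j _
      positivity
  have hsplit : ∑ j ∈ Finset.Icc (-J : ℤ) J, kernelBound j a b ^ 2 =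
      u ^ 2 + (∑ j ∈ Finset.Icc (-J : ℤ) J with 0 < j, kernelBound j a b ^ 2 +
      ∑ j ∈ Finset.Icc (-J : ℤ) J with j < 0, kernelBound j a b ^ 2) := by
    have h0 : u ^ 2 = kernelBound 0 a b ^ 2 := by simp [kernelBound, u]
    rw [h0, ← Finset.sum_union, ← Finset.sum_insert (f := fun j => kernelBound j a b ^ 2)]
    · congr 1
      ext j
      simp only [Finset.mem_insert, Finset.mem_union, Finset.mem_filter, Finset.mem_Icc]
      omega
    · simp
    · rw [Finset.disjoint_filter]
      intro j _ h
      omega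
  have huv : u * v = 8 / (max a b * Nat.dist a b : ℕ) := by
    simp only [u, v]
    push_cast
    rw [div_mul_div_comm, one_mul]
  have huu : u ^ 2 ≤ 1 / (max a b * Nat.dist a b : ℕ) := by
    simp only [u]
    rw [one_div_pow]
    apply one_div_le_one_div_of_le
    · push_cast
      push_cast at hA
      positivity
    · push_cast at hDA hA ⊢
      nlinarith
  rw [hsplit]
  -- The offset `j = 0` gives `u²`, and each sign of `j` gives `4 u v`; since `u v = 8 / (max *
  -- dist)`, the constant is `1 + 8 * 8 = 65`.
  calc _ ≤ 1 / (max a b * Nat.dist a b : ℕ) + 8 * (u * v) := by linarith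
    _ = _ := by
      rw [huv]
      ring

/-! ### The mean square sum over multiplicative quadruples -/

/-- The quadruples `(m₁, m₂), (m₃, m₄)` in `[1, R]` with `m₁ m₄ = m₂ m₃`. -/
def multQuadruples (R : ℕ) : Finset ((ℕ × ℕ) × (ℕ × ℕ)) :=
  ((Finset.Icc 1 R ×ˢ Finset.Icc 1 R) ×ˢ (Finset.Icc 1 R ×ˢ Finset.Icc 1 R)).filter
    fun z => z.1.1 * z.2.2 = z.1.2 * z.2.1

/-- The kernel bound restricted to pairs of distinct integers congruent modulo `q`. -/
noncomputable def modKernelBound (q : ℕ) (j : ℤ) (x : ℕ × ℕ) : ℝ :=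
  if x.1 ≠ x.2 ∧ q ∣ Nat.dist x.1 x.2 then kernelBound j x.1 x.2 else 0

theorem modKernelBound_nonneg (q : ℕ) (j : ℤ) (x : ℕ × ℕ) : 0 ≤ modKernelBound q j x := by
  unfold modKernelBound
  split_ifs
  · exact kernelBound_nonneg _ _ _
  · exact le_rfl

/-- The kernel bound is homogeneous of degree `-1`, so a common factor `k` separates as `1 / k`,
apart from its role in the congruence modulo `q`. -/
theorem modKernelBound_mul (q : ℕ) (j : ℤ) (a b : ℕ) {k : ℕ} (hk : 1 ≤ k) :
    modKernelBound q j (a * k, b * k) =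
      if a ≠ b then kernelBound j a b * (if q ∣ Nat.dist a b * k then 1 / (k : ℝ) else 0)
      else 0 := by
  unfold modKernelBound
  simp only [Nat.dist_mul_right, kernelBound_mul, ne_eq, Nat.mul_left_inj (by omega : k ≠ 0)]
  by_cases h1 : a = b <;> by_cases h2 : q ∣ Nat.dist a b * k <;> simp [h1, h2, div_eq_mul_inv]

/-- The equation `m₁ m₄ = m₂ m₃` says that the two pairs are proportional: they are `(a k, b k)` and
`(a l, b l)` with `k = gcd(m₁, m₂)`. For fixed `(a, b)` the sums over `k` and `l` form a square.
Coprimality of `a` and `b` is then dropped, which only enlarges the right side. -/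
theorem sum_multQuadruples_le (R : ℕ) {G : ℕ × ℕ → ℝ} (hG : ∀ x, 0 ≤ G x) :
    ∑ z ∈ multQuadruples R, G z.1 * G z.2 ≤
      ∑ x ∈ Finset.Icc 1 R ×ˢ Finset.Icc 1 R, (∑ k ∈ Finset.Icc 1 R, G (x.1 * k, x.2 * k)) ^ 2 := by
  have h1 : ∑ x ∈ Finset.Icc 1 R ×ˢ Finset.Icc 1 R,
      (∑ k ∈ Finset.Icc 1 R, G (x.1 * k, x.2 * k)) ^ 2 =
      ∑ y ∈ (Finset.Icc 1 R ×ˢ Finset.Icc 1 R) ×ˢ (Finset.Icc 1 R ×ˢ Finset.Icc 1 R),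
        G (y.1.1 * y.2.1, y.1.2 * y.2.1) * G (y.1.1 * y.2.2, y.1.2 * y.2.2) := by
    conv_rhs => rw [Finset.sum_product]
    refine Finset.sum_congr rfl fun x _ => ?_
    rw [sq, Finset.sum_mul_sum, ← Finset.sum_product']
  rw [h1]
  have key : ∀ z ∈ multQuadruples R, ∃ a b k l, 1 ≤ a ∧ 1 ≤ b ∧ 1 ≤ k ∧ 1 ≤ l ∧
      k = Nat.gcd z.1.1 z.1.2 ∧ a = z.1.1 / k ∧ b = z.1.2 / k ∧ l = z.2.1 / a ∧
      z = ((a * k, b * k), (a * l, b * l)) := by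
    rintro ⟨⟨m₁, m₂⟩, ⟨m₃, m₄⟩⟩ hz
    simp only [multQuadruples, Finset.mem_filter, Finset.mem_product, Finset.mem_Icc] at hz
    obtain ⟨⟨⟨h1, h2⟩, ⟨h3, h4⟩⟩, h⟩ := hz
    have hk : 0 < Nat.gcd m₁ m₂ := Nat.gcd_pos_of_pos_left _ h1.1
    obtain ⟨a, ha⟩ := Nat.gcd_dvd_left m₁ m₂
    obtain ⟨b, hb⟩ := Nat.gcd_dvd_right m₁ m₂
    set k := Nat.gcd m₁ m₂ with hkdef
    have hcop : Nat.Coprime a b := by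
      have := Nat.coprime_div_gcd_div_gcd hk
      rw [← hkdef, Nat.div_eq_of_eq_mul_right hk ha, Nat.div_eq_of_eq_mul_right hk hb] at this
      exact this
    have ha1 : 1 ≤ a := Nat.pos_of_ne_zero (by rintro rfl; omega)
    have hb1 : 1 ≤ b := Nat.pos_of_ne_zero (by rintro rfl; omega)
    have h' : a * m₄ = b * m₃ := by
      apply Nat.eq_of_mul_eq_mul_left hk
      rw [← mul_assoc, ← mul_assoc, ← ha, ← hb, h]
    obtain ⟨l, hl⟩ : a ∣ m₃ := hcop.dvd_of_dvd_mul_left ⟨m₄, h'.symm⟩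
    have hm4 : m₄ = b * l := by
      apply Nat.eq_of_mul_eq_mul_left (by omega : 0 < a)
      rw [h', hl]
      ring
    refine ⟨a, b, k, l, ha1, hb1, hk, Nat.pos_of_ne_zero (by rintro rfl; omega), rfl, ?_, ?_,
      ?_, ?_⟩
    · exact (Nat.div_eq_of_eq_mul_right hk ha).symm
    · exact (Nat.div_eq_of_eq_mul_right hk hb).symm
    · exact (Nat.div_eq_of_eq_mul_right ha1 hl).symm
    · rw [hm4, hl, mul_comm a k, mul_comm b k, ← ha, ← hb]
  refine sum_le_sum_of_leftInverse
    (fun z => ((z.1.1 / Nat.gcd z.1.1 z.1.2, z.1.2 / Nat.gcd z.1.1 z.1.2),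
      (Nat.gcd z.1.1 z.1.2, z.2.1 / (z.1.1 / Nat.gcd z.1.1 z.1.2))))
    (fun y => ((y.1.1 * y.2.1, y.1.2 * y.2.1), (y.1.1 * y.2.2, y.1.2 * y.2.2))) ?_ ?_ ?_ ?_
  · intro z hz
    obtain ⟨a, b, k, l, ha, hb, hk, hl, rfl, rfl, rfl, rfl, h⟩ := key z hz
    simp only [multQuadruples, Finset.mem_filter, Finset.mem_product, Finset.mem_Icc] at hz ⊢
    obtain ⟨⟨⟨h1, h2⟩, ⟨h3, h4⟩⟩, -⟩ := hz
    refine ⟨⟨⟨ha, (Nat.div_le_self _ _).trans h1.2⟩, ⟨hb, (Nat.div_le_self _ _).trans h2.2⟩⟩,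
      ⟨hk, (Nat.gcd_le_left _ h1.1).trans h1.2⟩, ⟨hl, (Nat.div_le_self _ _).trans h3.2⟩⟩
  · intro z hz
    obtain ⟨a, b, k, l, ha, hb, hk, hl, rfl, rfl, rfl, rfl, h⟩ := key z hz
    exact h.symm
  · intro z hz
    obtain ⟨a, b, k, l, ha, hb, hk, hl, rfl, rfl, rfl, rfl, h⟩ := key z hz
    have h1 := congrArg Prod.fst h
    have h2 := congrArg Prod.snd h
    exact le_of_eq (congrArg₂ (· * ·) (congrArg G h1) (congrArg G h2))
  · intro y _
    exact mul_nonneg (hG _) (hG _)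

/-- Because the bound covers the sum over all `q` and `j`, a later union bound over them is free.
With `D = |a - b|`, summing over `j` gives `1 / (max * D)`, summing over `q` gives `H²` times the
number of divisors of `D`, and the sum over `(a, b)` gives `H * H²`: five harmonic factors in all.
-/
theorem sum_sum_modKernelBound_le (Q J R : ℕ) :
    ∑ q ∈ Finset.Icc 1 Q, ∑ j ∈ Finset.Icc (-J : ℤ) J, ∑ z ∈ multQuadruples R,
      modKernelBound q j z.1 * modKernelBound q j z.2 ≤ 260 * harmonicSum R ^ 5 := by
  have h1 : ∀ q ∈ Finset.Icc 1 Q, ∀ j ∈ Finset.Icc (-J : ℤ) J, ∑ z ∈ multQuadruples R,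
      modKernelBound q j z.1 * modKernelBound q j z.2 ≤
      ∑ x ∈ Finset.Icc 1 R ×ˢ Finset.Icc 1 R with x.1 ≠ x.2, kernelBound j x.1 x.2 ^ 2 *
        (∑ k ∈ Finset.Icc 1 R with q ∣ Nat.dist x.1 x.2 * k, 1 / (k : ℝ)) ^ 2 := by
    intro q _ j _
    refine (sum_multQuadruples_le R (modKernelBound_nonneg q j)).trans (le_of_eq ?_)
    rw [Finset.sum_filter]
    refine Finset.sum_congr rfl fun x _ => ?_
    rw [Finset.sum_congr rfl fun k hk =>
      modKernelBound_mul q j x.1 x.2 (Finset.mem_Icc.1 hk).1]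
    split_ifs with h
    · rw [← Finset.mul_sum, mul_pow, Finset.sum_filter]
    · simp
  refine (Finset.sum_le_sum fun q hq => Finset.sum_le_sum fun j hj => h1 q hq j hj).trans ?_
  have h2 : ∑ q ∈ Finset.Icc 1 Q, ∑ j ∈ Finset.Icc (-J : ℤ) J,
      ∑ x ∈ Finset.Icc 1 R ×ˢ Finset.Icc 1 R with x.1 ≠ x.2, kernelBound j x.1 x.2 ^ 2 *
        (∑ k ∈ Finset.Icc 1 R with q ∣ Nat.dist x.1 x.2 * k, 1 / (k : ℝ)) ^ 2 =
      ∑ x ∈ Finset.Icc 1 R ×ˢ Finset.Icc 1 R with x.1 ≠ x.2,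
        (∑ j ∈ Finset.Icc (-J : ℤ) J, kernelBound j x.1 x.2 ^ 2) *
        ∑ q ∈ Finset.Icc 1 Q,
          (∑ k ∈ Finset.Icc 1 R with q ∣ Nat.dist x.1 x.2 * k, 1 / (k : ℝ)) ^ 2 := by
    simp only [Finset.sum_mul_sum]
    rw [Finset.sum_comm' (t' := Finset.Icc (-J : ℤ) J) (s' := fun _ => Finset.Icc 1 Q)
      (by simp [and_comm])]
    simp only [Finset.sum_comm (s := Finset.Icc 1 Q)]
    rw [Finset.sum_comm]
  rw [h2]
  set F : ℕ → ℝ := fun D => 130 * harmonicSum R ^ 2 * D.divisors.card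
  have h3 : ∀ x ∈ (Finset.Icc 1 R ×ˢ Finset.Icc 1 R).filter (fun x : ℕ × ℕ => x.1 ≠ x.2),
      (∑ j ∈ Finset.Icc (-J : ℤ) J, kernelBound j x.1 x.2 ^ 2) *
        ∑ q ∈ Finset.Icc 1 Q,
          (∑ k ∈ Finset.Icc 1 R with q ∣ Nat.dist x.1 x.2 * k, 1 / (k : ℝ)) ^ 2 ≤
      F (Nat.dist x.1 x.2) / (max x.1 x.2 * Nat.dist x.1 x.2 : ℕ) := by
    intro x hx
    simp only [Finset.mem_filter, Finset.mem_product, Finset.mem_Icc] at hx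
    calc _ ≤ 65 / (max x.1 x.2 * Nat.dist x.1 x.2 : ℕ) *
          (2 * harmonicSum R ^ 2 * (Nat.dist x.1 x.2).divisors.card) :=
          mul_le_mul (sum_kernelBound_sq_le hx.1.1.1 hx.2 J)
            (sum_sq_sum_filter_dvd_mul_le (Nat.dist_pos_of_ne hx.2) Q R)
            (Finset.sum_nonneg fun _ _ => by positivity) (by positivity)
      _ = _ := by
          simp only [F]
          ring
  refine (Finset.sum_le_sum h3).trans ((sum_filter_ne_le R fun D => by positivity).trans ?_)
  have h4 : ∑ D ∈ Finset.Icc 1 R, F D / D ≤ 130 * harmonicSum R ^ 2 * harmonicSum R ^ 2 := by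
    simp only [F, mul_div_assoc]
    rw [← Finset.mul_sum]
    exact mul_le_mul_of_nonneg_left (sum_card_divisors_div_le R) (by positivity)
  have h5 := harmonicSum_nonneg R
  calc _ ≤ 2 * harmonicSum R * (130 * harmonicSum R ^ 2 * harmonicSum R ^ 2) :=
        mul_le_mul_of_nonneg_left h4 (by positivity)
    _ = _ := by ring

/-! ### The conditional variance near rational points -/

/-- The coefficient of `f(n)`, `n` a large prime, in the exponential sum. -/
noncomputable def primeCoeff (g : ℕ → ℂ) (N n : ℕ) (θ : ℝ) : ℂ :=
  ∑ m ∈ Finset.Icc 1 (N / n), g m * e ((n * m : ℕ) * θ)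

/-- The sum over `n` between `T` and `N / max m₁ m₂` arising on expanding a square. -/
noncomputable def kernel (N T : ℕ) (x : ℕ × ℕ) (θ : ℝ) : ℂ :=
  ∑ n ∈ Finset.Icc T (N / max x.1 x.2), e (n * (((x.1 : ℝ) - x.2) * θ))

theorem abs_sub_eq_dist (a b : ℕ) : |(a : ℝ) - b| = (Nat.dist a b : ℝ) := by
  rcases le_total a b with h | h
  · rw [Nat.dist_eq_sub_of_le h, Nat.cast_sub h, abs_of_nonpos (by simpa using h)]
    ring
  · rw [Nat.dist_eq_sub_of_le_right h, Nat.cast_sub h, abs_of_nonneg (by simpa using h)]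

/-- The conditions `m₁, m₂ ≤ N / n` become `n ≤ N / max m₁ m₂`, so that `(m₁, m₂)` has a range
independent of `n` and the sums can be exchanged. -/
theorem norm_sq_primeCoeff (g : ℕ → ℂ) {N T n : ℕ} (hT : 1 ≤ T) (hn : T ≤ n) (θ : ℝ) :
    ((‖primeCoeff g N n θ‖ ^ 2 : ℝ) : ℂ) =
      ∑ x ∈ Finset.Icc 1 (N / T) ×ˢ Finset.Icc 1 (N / T), if n ≤ N / max x.1 x.2 then
        g x.1 * (starRingEnd ℂ) (g x.2) * e (n * (((x.1 : ℝ) - x.2) * θ)) else 0 := by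
  have hsub : N / n ≤ N / T := Nat.div_le_div_left hn hT
  rw [Complex.ofReal_pow, ← Complex.mul_conj', primeCoeff, map_sum, Finset.sum_mul_sum,
    ← Finset.sum_product', ← Finset.sum_filter]
  refine Finset.sum_congr ?_ fun x _ => ?_
  · ext x
    have : ∀ m, m ≤ N / n ↔ n * m ≤ N := fun m => by
      rw [Nat.le_div_iff_mul_le (by omega), mul_comm]
    simp only [Finset.mem_filter, Finset.mem_product, Finset.mem_Icc]
    constructor
    · rintro ⟨⟨h1, h2⟩, h3, h4⟩
      refine ⟨⟨⟨h1, by omega⟩, h3, by omega⟩, ?_⟩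
      rw [Nat.le_div_iff_mul_le (by omega)]
      rw [this] at h2 h4
      rcases max_choice x.1 x.2 with h | h <;> rw [h] <;> assumption
    · rintro ⟨⟨⟨h1, h2⟩, h3, h4⟩, h5⟩
      rw [Nat.le_div_iff_mul_le (by omega)] at h5
      refine ⟨⟨h1, (this _).2 (le_trans ?_ h5)⟩, h3, (this _).2 (le_trans ?_ h5)⟩
      · exact Nat.mul_le_mul_left _ (le_max_left _ _)
      · exact Nat.mul_le_mul_left _ (le_max_right _ _)
  · rw [map_mul, conj_e, mul_mul_mul_comm, ← e_add]
    push_cast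
    ring_nf

theorem sum_norm_sq_primeCoeff (g : ℕ → ℂ) {N T : ℕ} (hT : 1 ≤ T) (θ : ℝ) :
    ((∑ n ∈ Finset.Icc T N, ‖primeCoeff g N n θ‖ ^ 2 : ℝ) : ℂ) =
      ∑ x ∈ Finset.Icc 1 (N / T) ×ˢ Finset.Icc 1 (N / T),
        g x.1 * (starRingEnd ℂ) (g x.2) * kernel N T x θ := by
  rw [Complex.ofReal_sum, Finset.sum_congr rfl fun n hn =>
    norm_sq_primeCoeff g hT (Finset.mem_Icc.1 hn).1 θ, Finset.sum_comm]
  refine Finset.sum_congr rfl fun x _ => ?_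
  rw [← Finset.sum_filter, kernel, Finset.mul_sum]
  refine Finset.sum_congr ?_ fun _ _ => rfl
  ext n
  have := Nat.div_le_self N (max x.1 x.2)
  simp only [Finset.mem_filter, Finset.mem_Icc]
  omega

/-- The coefficients of the part of the variance that comes from pairs congruent modulo `q`. -/
noncomputable def modKernel (N T q : ℕ) (j : ℤ) (x : ℕ × ℕ) : ℂ :=
  if x.1 ≠ x.2 ∧ q ∣ Nat.dist x.1 x.2 then kernel N T x (j / (16 * N)) else 0

theorem norm_kernel_le_div {N T : ℕ} (hT : 1 ≤ T) (x : ℕ × ℕ) (θ : ℝ) :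
    ‖kernel N T x θ‖ ≤ N / (max x.1 x.2 : ℕ) :=
  (norm_sum_e_mul_le_card hT _ _).trans Nat.cast_div_le

theorem norm_kernel_le {N T R : ℕ} (hN : 1 ≤ N) (hT : 1 ≤ T) {x : ℕ × ℕ} {j : ℤ}
    (hx : x ∈ Finset.Icc 1 R ×ˢ Finset.Icc 1 R) (hne : x.1 ≠ x.2)
    (hj : |(j : ℝ) / (16 * N)| * R ≤ 1 / 2) :
    ‖kernel N T x (j / (16 * N))‖ ≤ N * kernelBound j x.1 x.2 := by
  have h1 : ‖kernel N T x (j / (16 * N))‖ ≤ N * (1 / (max x.1 x.2 : ℕ)) := by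
    rw [mul_one_div]
    exact norm_kernel_le_div hT x _
  unfold kernelBound
  split_ifs with h0
  · exact h1
  rw [mul_min_of_nonneg _ _ (Nat.cast_nonneg N)]
  refine le_min h1 ?_
  have hd : Nat.dist x.1 x.2 ≤ R := by
    simp only [Finset.mem_product, Finset.mem_Icc] at hx
    unfold Nat.dist
    omega
  have hd' : (Nat.dist x.1 x.2 : ℝ) ≤ R := by exact_mod_cast hd
  have hd0 : (0 : ℝ) < Nat.dist x.1 x.2 := by exact_mod_cast Nat.dist_pos_of_ne hne
  have hN0 : (0 : ℝ) < N := by exact_mod_cast hN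
  have hj0 : (0 : ℝ) < |(j : ℝ)| := by simpa using h0
  have habs : |((x.1 : ℝ) - x.2) * (j / (16 * N))| = Nat.dist x.1 x.2 * |(j : ℝ) / (16 * N)| := by
    rw [abs_mul, abs_sub_eq_dist]
  have habs' : |(j : ℝ) / (16 * N)| = |(j : ℝ)| / (16 * N) := by
    rw [abs_div, abs_of_pos (by positivity : (0 : ℝ) < 16 * N)]
  have h2 : |((x.1 : ℝ) - x.2) * (j / (16 * N))| ≤ 1 / 2 := by
    rw [habs, mul_comm]
    exact (mul_le_mul_of_nonneg_left hd' (abs_nonneg _)).trans hj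
  have h3 : ((x.1 : ℝ) - x.2) * (j / (16 * N)) ≠ 0 := by
    rw [← abs_pos, habs, habs']
    positivity
  -- The geometric sum is at most `1 / (2 |x|)` with `|x| = dist * |j| / (16 N)`, which produces the
  -- `8` in `kernelBound`.
  refine (norm_sum_e_mul_le_inv h2 h3).trans (le_of_eq ?_)
  rw [habs, habs', Nat.cast_natAbs, Int.cast_abs]
  field_simp
  norm_num

theorem norm_modKernel_le {N T R q : ℕ} (hN : 1 ≤ N) (hT : 1 ≤ T) {x : ℕ × ℕ} {j : ℤ}
    (hx : x ∈ Finset.Icc 1 R ×ˢ Finset.Icc 1 R) (hj : |(j : ℝ) / (16 * N)| * R ≤ 1 / 2) :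
    ‖modKernel N T q j x‖ ≤ N * modKernelBound q j x := by
  unfold modKernel modKernelBound
  split_ifs with h
  · exact norm_kernel_le hN hT hx h.1 hj
  · simp

/-- The rational part shifts each phase by an integer. Independence of `a` is what reduces the
random events to be controlled to the pairs `(q, j)`. -/
theorem kernel_eq_of_dvd {q : ℕ} (hq : 1 ≤ q) (N T : ℕ) {x : ℕ × ℕ} (h : q ∣ Nat.dist x.1 x.2)
    (a : ℤ) (β : ℝ) : kernel N T x (a / q + β) = kernel N T x β := by
  have h' : (q : ℤ) ∣ (x.1 : ℤ) - x.2 := by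
    rw [← Int.dvd_natAbs, Int.natCast_dvd_natCast]
    convert h using 1
    unfold Nat.dist
    omega
  obtain ⟨c, hc⟩ := h'
  have hc' : (x.1 : ℝ) - x.2 = q * c := by exact_mod_cast hc
  have hq0 : (q : ℝ) ≠ 0 := by positivity
  refine Finset.sum_congr rfl fun n _ => ?_
  rw [← e_add_intCast (n * (((x.1 : ℝ) - x.2) * β)) (n * (c * a))]
  congr 1
  push_cast
  rw [hc']
  field_simp
  ring

/-- Since `q ∤ (m₁ - m₂) a`, the rational part of the frequency is at least `1 / q` from every
integer, and `β` moves it by at most `1 / (2 q)`; the geometric sum is then at most `q`. -/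
theorem norm_kernel_le_of_not_dvd {q R : ℕ} (hq : 1 ≤ q) (N T : ℕ) {x : ℕ × ℕ}
    (hx : x ∈ Finset.Icc 1 R ×ˢ Finset.Icc 1 R) (h : ¬ q ∣ Nat.dist x.1 x.2)
    {a : ℤ} (ha : IsCoprime a q) {β : ℝ} (hβ : |β| * R ≤ 1 / (2 * q)) :
    ‖kernel N T x (a / q + β)‖ ≤ q := by
  have h' : ¬ (q : ℤ) ∣ (x.1 : ℤ) - x.2 := by
    rw [← Int.dvd_natAbs, Int.natCast_dvd_natCast]
    convert h using 2
    unfold Nat.dist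
    omega
  have hq0 : (0 : ℝ) < q := by exact_mod_cast hq
  have hd : (Nat.dist x.1 x.2 : ℝ) ≤ R := by
    have : Nat.dist x.1 x.2 ≤ R := by
      simp only [Finset.mem_product, Finset.mem_Icc] at hx
      unfold Nat.dist
      omega
    exact_mod_cast this
  have key : ∀ k : ℤ, 1 / (2 * (q : ℝ)) ≤ |((x.1 : ℝ) - x.2) * (a / q + β) - k| := by
    intro k
    have hne : ((x.1 : ℤ) - x.2) * a - q * k ≠ 0 := by
      intro h0
      apply h'
      exact ha.symm.dvd_of_dvd_mul_right ⟨k, by linarith⟩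
    have h1 : (1 : ℝ) ≤ |((x.1 : ℝ) - x.2) * a - q * k| := by
      exact_mod_cast Int.one_le_abs hne
    have h2 : 1 / (q : ℝ) ≤ |((x.1 : ℝ) - x.2) * (a / q) - k| := by
      have : ((x.1 : ℝ) - x.2) * (a / q) - k = (((x.1 : ℝ) - x.2) * a - q * k) / q := by
        field_simp
      rw [this, abs_div, abs_of_pos hq0]
      exact div_le_div_of_nonneg_right h1 hq0.le
    have h3 : |((x.1 : ℝ) - x.2) * β| ≤ 1 / (2 * q) := by
      rw [abs_mul, abs_sub_eq_dist, mul_comm]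
      exact (mul_le_mul_of_nonneg_left hd (abs_nonneg _)).trans hβ
    have h4 : ((x.1 : ℝ) - x.2) * (a / q) - k =
        (((x.1 : ℝ) - x.2) * (a / q + β) - k) - ((x.1 : ℝ) - x.2) * β := by ring
    have h5 := abs_sub (((x.1 : ℝ) - x.2) * (a / q + β) - k) (((x.1 : ℝ) - x.2) * β)
    rw [← h4] at h5
    have h6 : 1 / (q : ℝ) = 1 / (2 * q) + 1 / (2 * q) := by
      field_simp
      norm_num
    linarith
  refine (norm_sum_e_mul_le_of_sub_intCast (by positivity) key).trans (le_of_eq ?_)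
  field_simp

/-- The contribution to the variance near `a / q` of the pairs congruent modulo `q`. -/
noncomputable def offDiagonal (g : ℕ → ℂ) (N T q : ℕ) (j : ℤ) : ℂ :=
  ∑ x ∈ Finset.Icc 1 (N / T) ×ˢ Finset.Icc 1 (N / T),
    modKernel N T q j x * (g x.1 * (starRingEnd ℂ) (g x.2))

/-- The three terms come from the diagonal, from the pairs incongruent modulo `q`, and from the
distinct congruent pairs. -/
theorem sum_norm_sq_primeCoeff_le {g : ℕ → ℂ} {N T q : ℕ} (hT : 1 ≤ T) (hq : 1 ≤ q)
    (hg : ∀ m ∈ Finset.Icc 1 (N / T), ‖g m‖ = 1) {a j : ℤ} (ha : IsCoprime a q)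
    (hj : |(j : ℝ) / (16 * N)| * (N / T : ℕ) ≤ 1 / (2 * q)) :
    ∑ n ∈ Finset.Icc T N, ‖primeCoeff g N n (a / q + j / (16 * N))‖ ^ 2 ≤
      N * harmonicSum (N / T) + ((N / T : ℕ) : ℝ) ^ 2 * q + ‖offDiagonal g N T q j‖ := by
  set R := N / T with hR
  set θ : ℝ := a / q + j / (16 * N)
  have h0 := sum_norm_sq_primeCoeff g (N := N) hT θ
  have hgg : ∀ x ∈ Finset.Icc 1 R ×ˢ Finset.Icc 1 R, ‖g x.1 * (starRingEnd ℂ) (g x.2)‖ = 1 := by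
    intro x hx
    rw [Finset.mem_product] at hx
    rw [norm_mul, RCLike.norm_conj, hg _ hx.1, hg _ hx.2, one_mul]
  have h1 : ∑ x ∈ Finset.Icc 1 R ×ˢ Finset.Icc 1 R,
        g x.1 * (starRingEnd ℂ) (g x.2) * kernel N T x θ =
      ∑ x ∈ Finset.Icc 1 R ×ˢ Finset.Icc 1 R, g x.1 * (starRingEnd ℂ) (g x.2) *
        (kernel N T x θ - modKernel N T q j x) + offDiagonal g N T q j := by
    rw [offDiagonal, ← Finset.sum_add_distrib]
    exact Finset.sum_congr rfl fun x _ => by ring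
  have h2 : ∀ x ∈ Finset.Icc 1 R ×ˢ Finset.Icc 1 R, ‖g x.1 * (starRingEnd ℂ) (g x.2) *
        (kernel N T x θ - modKernel N T q j x)‖ ≤ (if x.1 = x.2 then (N : ℝ) / x.1 else 0) + q := by
    intro x hx
    rw [norm_mul, hgg x hx, one_mul, modKernel]
    by_cases h : x.1 = x.2
    · have := norm_kernel_le_div (N := N) hT x θ
      simp only [h, max_self, ne_eq, not_true, false_and, if_false, sub_zero, if_true] at this ⊢
      have : (0 : ℝ) ≤ q := Nat.cast_nonneg q
      linarith
    · by_cases h' : q ∣ Nat.dist x.1 x.2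
      · rw [if_pos ⟨h, h'⟩, kernel_eq_of_dvd hq N T h', sub_self, norm_zero, if_neg h, zero_add]
        exact Nat.cast_nonneg _
      · rw [if_neg (fun H => h' H.2), sub_zero, if_neg h, zero_add]
        exact norm_kernel_le_of_not_dvd hq N T hx h' ha hj
  have h3 : ∑ x ∈ Finset.Icc 1 R ×ˢ Finset.Icc 1 R,
      ((if x.1 = x.2 then (N : ℝ) / x.1 else 0) + q) = N * harmonicSum R + (R : ℝ) ^ 2 * q := by
    rw [Finset.sum_add_distrib, Finset.sum_const, Finset.card_product, Nat.card_Icc,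
      Finset.sum_product]
    congr 1
    · rw [harmonicSum, Finset.mul_sum]
      refine Finset.sum_congr rfl fun m hm => ?_
      rw [Finset.sum_ite_eq, if_pos hm, mul_one_div]
    · rw [nsmul_eq_mul, Nat.add_sub_cancel, Nat.cast_mul]
      ring
  calc _ ≤ ‖((∑ n ∈ Finset.Icc T N, ‖primeCoeff g N n θ‖ ^ 2 : ℝ) : ℂ)‖ := by
        rw [Complex.norm_real]
        exact le_abs_self _
    _ ≤ _ := by
        rw [h0, h1]
        refine (norm_add_le _ _).trans (add_le_add_left ?_ _)
        exact (norm_sum_le _ _).trans ((Finset.sum_le_sum h2).trans h3.le)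

/-! ### Steinhaus random multiplicative functions: orthogonality and second moments -/

theorem integral_uniformCircle {φ : ℂ → ℂ} (hφ : Continuous φ) :
    ∫ z, φ z ∂uniformCircle = ∫ t in (0 : ℝ)..1, φ (e t) := by
  rw [uniformCircle, integral_map continuous_e.aemeasurable hφ.aestronglyMeasurable,
    intervalIntegral.integral_of_le zero_le_one, integral_Icc_eq_integral_Ioc]

theorem integral_uniformCircle_pow_mul_conj_pow (a b : ℕ) :
    ∫ z, z ^ a * (starRingEnd ℂ) z ^ b ∂uniformCircle = if a = b then 1 else 0 := by
  rw [integral_uniformCircle (by fun_prop)]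
  have h : ∀ t : ℝ, e t ^ a * (starRingEnd ℂ) (e t) ^ b = e (((a : ℤ) - b : ℤ) * t) := by
    intro t
    rw [conj_e, ← e_nat_mul, ← e_nat_mul, ← e_add]
    push_cast
    ring_nf
  simp only [h, integral_e_intCast_mul, sub_eq_zero, Nat.cast_inj]

theorem ae_norm_uniformCircle : ∀ᵐ z ∂uniformCircle, ‖z‖ = 1 := by
  rw [uniformCircle, ae_map_iff continuous_e.aemeasurable
    (isClosed_eq continuous_norm continuous_const).measurableSet]
  exact Filter.Eventually.of_forall norm_e

namespace IsSteinhaus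

variable {Ω : Type*} [MeasurableSpace Ω] {μ : Measure Ω} {f : ℕ → Ω → ℂ}

theorem eq_prod_of_subset (hf : IsSteinhaus μ f) {n : ℕ} (hn : n ≠ 0) {s : Finset ℕ}
    (hs : ∀ p ∈ s, p.Prime) (hns : n.primeFactors ⊆ s) (ω : Ω) :
    f n ω = ∏ p ∈ s, f p ω ^ padicValNat p n := by
  rw [hf.eq_prod n hn]
  refine Finset.prod_subset hns fun p hp hpn => ?_
  rw [padicValNat.eq_zero_of_not_dvd, pow_zero]
  exact fun h => hpn (Nat.mem_primeFactors.2 ⟨hs p hp, h, hn⟩)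

theorem map_mul (hf : IsSteinhaus μ f) {m n : ℕ} (hm : m ≠ 0) (hn : n ≠ 0) (ω : Ω) :
    f (m * n) ω = f m ω * f n ω := by
  have hp : ∀ p ∈ (m * n).primeFactors, p.Prime := fun p => Nat.prime_of_mem_primeFactors
  rw [hf.eq_prod _ (mul_ne_zero hm hn),
    hf.eq_prod_of_subset hm hp (Nat.primeFactors_mono (dvd_mul_right _ _) (mul_ne_zero hm hn)),
    hf.eq_prod_of_subset hn hp (Nat.primeFactors_mono (dvd_mul_left _ _) (mul_ne_zero hm hn)),
    ← Finset.prod_mul_distrib]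
  refine Finset.prod_congr rfl fun p hpp => ?_
  have : Fact p.Prime := ⟨hp p hpp⟩
  rw [padicValNat.mul hm hn, pow_add]

theorem measurable (hf : IsSteinhaus μ f) {n : ℕ} (hn : n ≠ 0) : Measurable (f n) := by
  have : f n = fun ω => ∏ p ∈ n.primeFactors, f p ω ^ padicValNat p n :=
    funext (hf.eq_prod n hn)
  rw [this]
  exact Finset.measurable_fun_prod _ fun p hp =>
    (hf.measurable_prime ⟨p, Nat.prime_of_mem_primeFactors hp⟩).pow_const _

theorem ae_norm_eq_one (hf : IsSteinhaus μ f) : ∀ᵐ ω ∂μ, ∀ n ≠ 0, ‖f n ω‖ = 1 := by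
  have h : ∀ᵐ ω ∂μ, ∀ p : Nat.Primes, ‖f p ω‖ = 1 := by
    rw [ae_all_iff]
    intro p
    have h1 := ae_norm_uniformCircle
    rw [← hf.law_prime p] at h1
    exact ae_of_ae_map (hf.measurable_prime p).aemeasurable h1
  filter_upwards [h] with ω hω n hn
  rw [hf.eq_prod n hn, norm_prod]
  refine Finset.prod_eq_one fun p hp => ?_
  rw [norm_pow, hω ⟨p, Nat.prime_of_mem_primeFactors hp⟩, one_pow]

theorem integral_pow_mul_conj_pow (hf : IsSteinhaus μ f) (p : Nat.Primes) (a b : ℕ) :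
    ∫ ω, f p ω ^ a * (starRingEnd ℂ) (f p ω) ^ b ∂μ = if a = b then 1 else 0 := by
  rw [← integral_uniformCircle_pow_mul_conj_pow, ← hf.law_prime p,
    integral_map (hf.measurable_prime p).aemeasurable]
  exact Continuous.aestronglyMeasurable (by fun_prop)

/-- By independence the integral factors over the primes dividing `m n`, and a prime whose exponents
in `m` and `n` differ contributes a zero factor. -/
theorem integral_mul_conj (hf : IsSteinhaus μ f) {m n : ℕ} (hm : m ≠ 0) (hn : n ≠ 0) :
    ∫ ω, f m ω * (starRingEnd ℂ) (f n ω) ∂μ = if m = n then 1 else 0 := by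
  have hs : ∀ p ∈ (m * n).primeFactors, p.Prime := fun p => Nat.prime_of_mem_primeFactors
  have hm' := hf.eq_prod_of_subset hm hs
    (Nat.primeFactors_mono (dvd_mul_right _ _) (mul_ne_zero hm hn))
  have hn' := hf.eq_prod_of_subset hn hs
    (Nat.primeFactors_mono (dvd_mul_left _ _) (mul_ne_zero hm hn))
  let g : (m * n).primeFactors → Nat.Primes := fun p => ⟨p, hs p p.2⟩
  have hg : Function.Injective g := fun p q h =>
    Subtype.ext (congrArg (fun r : Nat.Primes => (r : ℕ)) h)
  have hind := hf.indep_prime.precomp hg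
  have h1 : ∀ ω, f m ω * (starRingEnd ℂ) (f n ω) = ∏ p : (m * n).primeFactors,
      (f (g p) ω ^ padicValNat p m * (starRingEnd ℂ) (f (g p) ω) ^ padicValNat p n) := by
    intro ω
    rw [hm', hn', _root_.map_prod, ← Finset.prod_mul_distrib, ← Finset.prod_coe_sort]
    simp only [map_pow, g]
  have h2 := hind.integral_fun_prod_comp (fun p => (hf.measurable_prime (g p)).aemeasurable)
    (f := fun (p : (m * n).primeFactors) z => z ^ padicValNat p m * (starRingEnd ℂ) z ^ padicValNat p n)
    (fun p => Continuous.aestronglyMeasurable (by fun_prop))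
  simp only [h1]
  rw [h2]
  simp only [hf.integral_pow_mul_conj_pow]
  split_ifs with h
  · subst h
    simp
  · obtain ⟨p, hpp, hp⟩ : ∃ p : ℕ, p.Prime ∧ padicValNat p m ≠ padicValNat p n := by
      by_contra! hcon
      exact h ((Nat.eq_iff_prime_padicValNat_eq m n hm hn).2 hcon)
    have hpm : p ∈ (m * n).primeFactors := by
      by_contra hp'
      have hnd : ¬ p ∣ m * n := fun H =>
        hp' (Nat.mem_primeFactors.2 ⟨hpp, H, mul_ne_zero hm hn⟩)
      apply hp
      rw [padicValNat.eq_zero_of_not_dvd fun H => hnd (dvd_mul_of_dvd_left H _),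
        padicValNat.eq_zero_of_not_dvd fun H => hnd (dvd_mul_of_dvd_right H _)]
    exact Finset.prod_eq_zero (Finset.mem_univ ⟨p, hpm⟩) (if_neg hp)

theorem integrable_mul_conj [IsProbabilityMeasure μ] (hf : IsSteinhaus μ f) {m n : ℕ}
    (hm : m ≠ 0) (hn : n ≠ 0) : Integrable (fun ω => f m ω * (starRingEnd ℂ) (f n ω)) μ := by
  refine Integrable.of_bound ((hf.measurable hm).mul
    (Complex.continuous_conj.measurable.comp (hf.measurable hn))).aestronglyMeasurable 1 ?_
  filter_upwards [hf.ae_norm_eq_one] with ω hω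
  rw [norm_mul, RCLike.norm_conj, hω m hm, hω n hn, one_mul]

theorem norm_sq_sum_mul_conj (hf : IsSteinhaus μ f) (R : ℕ) (w : ℕ × ℕ → ℂ) (ω : Ω) :
    ((‖∑ x ∈ Finset.Icc 1 R ×ˢ Finset.Icc 1 R,
      w x * (f x.1 ω * (starRingEnd ℂ) (f x.2 ω))‖ ^ 2 : ℝ) : ℂ) =
    ∑ z ∈ (Finset.Icc 1 R ×ˢ Finset.Icc 1 R) ×ˢ (Finset.Icc 1 R ×ˢ Finset.Icc 1 R),
      w z.1 * (starRingEnd ℂ) (w z.2) *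
        (f (z.1.1 * z.2.2) ω * (starRingEnd ℂ) (f (z.1.2 * z.2.1) ω)) := by
  rw [Complex.ofReal_pow, ← Complex.mul_conj', map_sum, Finset.sum_mul_sum,
    ← Finset.sum_product']
  refine Finset.sum_congr rfl fun z hz => ?_
  simp only [Finset.mem_product, Finset.mem_Icc] at hz
  rw [hf.map_mul (by omega) (by omega), hf.map_mul (by omega) (by omega)]
  simp only [_root_.map_mul, Complex.conj_conj]
  ring

/-- Expanding the square gives `f(m₁ m₄)` against the conjugate of `f(m₂ m₃)`; orthogonality keeps
exactly the multiplicative quadruples. -/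
theorem integral_norm_sq_sum_le [IsProbabilityMeasure μ] (hf : IsSteinhaus μ f) (R : ℕ)
    (w : ℕ × ℕ → ℂ) :
    Integrable (fun ω => ‖∑ x ∈ Finset.Icc 1 R ×ˢ Finset.Icc 1 R,
      w x * (f x.1 ω * (starRingEnd ℂ) (f x.2 ω))‖ ^ 2) μ ∧
    ∫ ω, ‖∑ x ∈ Finset.Icc 1 R ×ˢ Finset.Icc 1 R,
      w x * (f x.1 ω * (starRingEnd ℂ) (f x.2 ω))‖ ^ 2 ∂μ ≤
      ∑ z ∈ multQuadruples R, ‖w z.1‖ * ‖w z.2‖ := by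
  have hint : ∀ z ∈ (Finset.Icc 1 R ×ˢ Finset.Icc 1 R) ×ˢ (Finset.Icc 1 R ×ˢ Finset.Icc 1 R),
      Integrable (fun ω => w z.1 * (starRingEnd ℂ) (w z.2) *
        (f (z.1.1 * z.2.2) ω * (starRingEnd ℂ) (f (z.1.2 * z.2.1) ω))) μ := by
    intro z hz
    simp only [Finset.mem_product, Finset.mem_Icc] at hz
    exact (hf.integrable_mul_conj (mul_ne_zero (by omega) (by omega))
      (mul_ne_zero (by omega) (by omega))).const_mul _
  constructor
  · have h := (integrable_finsetSum _ hint).re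
    refine h.congr (Filter.Eventually.of_forall fun ω => ?_)
    simp only
    rw [← hf.norm_sq_sum_mul_conj]
    exact Complex.ofReal_re _
  · have h1 : ((∫ ω, ‖∑ x ∈ Finset.Icc 1 R ×ˢ Finset.Icc 1 R,
        w x * (f x.1 ω * (starRingEnd ℂ) (f x.2 ω))‖ ^ 2 ∂μ : ℝ) : ℂ) =
        ∑ z ∈ multQuadruples R, w z.1 * (starRingEnd ℂ) (w z.2) := by
      rw [← integral_complex_ofReal]
      simp only [hf.norm_sq_sum_mul_conj]
      rw [integral_finsetSum _ hint, multQuadruples, Finset.sum_filter]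
      refine Finset.sum_congr rfl fun z hz => ?_
      simp only [Finset.mem_product, Finset.mem_Icc] at hz
      rw [integral_const_mul, hf.integral_mul_conj (mul_ne_zero (by omega) (by omega))
        (mul_ne_zero (by omega) (by omega))]
      simp
    calc _ ≤ ‖((∫ ω, ‖∑ x ∈ Finset.Icc 1 R ×ˢ Finset.Icc 1 R,
          w x * (f x.1 ω * (starRingEnd ℂ) (f x.2 ω))‖ ^ 2 ∂μ : ℝ) : ℂ)‖ := by
          rw [Complex.norm_real]
          exact le_abs_self _
      _ ≤ _ := by
          rw [h1]
          refine (norm_sum_le _ _).trans (le_of_eq (Finset.sum_congr rfl fun z _ => ?_))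
          rw [norm_mul, RCLike.norm_conj]

theorem measureReal_offDiagonal_le [IsProbabilityMeasure μ] (hf : IsSteinhaus μ f) {N T : ℕ}
    (hN : 1 ≤ N) (hT : 1 ≤ T) {q : ℕ} {j : ℤ}
    (hj : |(j : ℝ) / (16 * N)| * (N / T : ℕ) ≤ 1 / 2) {t : ℝ} (ht : 0 < t) :
    μ.real {ω | t < ‖offDiagonal (fun n => f n ω) N T q j‖} ≤
      (N / t) ^ 2 * ∑ z ∈ multQuadruples (N / T), modKernelBound q j z.1 * modKernelBound q j z.2 := by
  obtain ⟨hint, hle⟩ := hf.integral_norm_sq_sum_le (N / T) (modKernel N T q j)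
  have h1 := mul_meas_ge_le_integral_of_nonneg
    (Filter.Eventually.of_forall fun ω => by positivity) hint (t ^ 2)
  have h2 : ∑ z ∈ multQuadruples (N / T), ‖modKernel N T q j z.1‖ * ‖modKernel N T q j z.2‖ ≤
      N ^ 2 * ∑ z ∈ multQuadruples (N / T), modKernelBound q j z.1 * modKernelBound q j z.2 := by
    rw [Finset.mul_sum]
    refine Finset.sum_le_sum fun z hz => ?_
    rw [multQuadruples, Finset.mem_filter, Finset.mem_product] at hz
    have := mul_le_mul (norm_modKernel_le (q := q) hN hT hz.1.1 hj)
      (norm_modKernel_le (q := q) hN hT hz.1.2 hj) (norm_nonneg _)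
      (mul_nonneg (Nat.cast_nonneg _) (modKernelBound_nonneg _ _ _))
    linarith
  have h3 : μ.real {ω | t < ‖offDiagonal (fun n => f n ω) N T q j‖} ≤
      μ.real {ω | t ^ 2 ≤ ‖∑ x ∈ Finset.Icc 1 (N / T) ×ˢ Finset.Icc 1 (N / T),
        modKernel N T q j x * (f x.1 ω * (starRingEnd ℂ) (f x.2 ω))‖ ^ 2} :=
    measureReal_mono fun ω hω => pow_le_pow_left₀ ht.le (le_of_lt hω) 2
  refine h3.trans ?_
  rw [div_pow, div_mul_eq_mul_div, le_div_iff₀ (by positivity), mul_comm]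
  exact h1.trans (hle.trans h2)

/-- With high probability all off-diagonal contributions are small simultaneously. -/
theorem measureReal_exists_offDiagonal_le [IsProbabilityMeasure μ] (hf : IsSteinhaus μ f)
    {N T : ℕ} (hN : 1 ≤ N) (hT : 1 ≤ T) (Q J : ℕ) {I : Finset (ℕ × ℤ)}
    (hI : I ⊆ Finset.Icc 1 Q ×ˢ Finset.Icc (-J : ℤ) J)
    (hj : ∀ i ∈ I, |(i.2 : ℝ) / (16 * N)| * (N / T : ℕ) ≤ 1 / 2) {t : ℝ} (ht : 0 < t) :
    μ.real {ω | ∃ i ∈ I, t < ‖offDiagonal (fun n => f n ω) N T i.1 i.2‖} ≤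
      260 * (N / t) ^ 2 * harmonicSum (N / T) ^ 5 := by
  have h1 : {ω | ∃ i ∈ I, t < ‖offDiagonal (fun n => f n ω) N T i.1 i.2‖} =
      ⋃ i ∈ I, {ω | t < ‖offDiagonal (fun n => f n ω) N T i.1 i.2‖} := by
    ext ω
    simp
  rw [h1]
  refine (measureReal_biUnion_finset_le _ _).trans ?_
  refine (Finset.sum_le_sum fun i hi => hf.measureReal_offDiagonal_le hN hT (hj i hi) ht).trans ?_
  rw [← Finset.mul_sum]
  have h2 : ∑ i ∈ I, ∑ z ∈ multQuadruples (N / T),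
      modKernelBound i.1 i.2 z.1 * modKernelBound i.1 i.2 z.2 ≤ 260 * harmonicSum (N / T) ^ 5 := by
    refine le_trans (Finset.sum_le_sum_of_subset_of_nonneg hI fun i _ _ =>
      Finset.sum_nonneg fun z _ => mul_nonneg (modKernelBound_nonneg _ _ _)
        (modKernelBound_nonneg _ _ _)) ?_
    exact (Finset.sum_product' _ _ fun (q : ℕ) (j : ℤ) => ∑ z ∈ multQuadruples (N / T),
      modKernelBound q j z.1 * modKernelBound q j z.2).le.trans
        (sum_sum_modKernelBound_le Q J (N / T))
  calc _ ≤ (N / t) ^ 2 * (260 * harmonicSum (N / T) ^ 5) :=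
        mul_le_mul_of_nonneg_left h2 (by positivity)
    _ = _ := by ring

end IsSteinhaus

/-! ### Concentration over the large primes, conditionally on the small ones -/

theorem _root_.ProbabilityTheory.HasSubgaussianMGF.of_le {Ω : Type*} [MeasurableSpace Ω]
    {μ : Measure Ω} {X : Ω → ℝ} {c c' : NNReal} (h : HasSubgaussianMGF X c μ) (hc : c ≤ c') :
    HasSubgaussianMGF X c' μ where
  integrable_exp_mul := h.integrable_exp_mul
  mgf_le t := (h.mgf_le t).trans (by gcongr)

/-- Fubini on the product law: a bound uniform over frozen values of `X` is a bound for the joint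
event. It replaces conditioning on the small primes. -/
theorem _root_.ProbabilityTheory.IndepFun.measure_prodMk_mem_le {Ω α β : Type*}
    [MeasurableSpace Ω] [MeasurableSpace α] [MeasurableSpace β] {μ : Measure Ω}
    [IsProbabilityMeasure μ] {X : Ω → α} {Y : Ω → β} (hXY : IndepFun X Y μ) (hX : Measurable X)
    (hY : Measurable Y) {A : Set (α × β)} (hA : MeasurableSet A) {δ : ENNReal}
    (h : ∀ x, μ {ω | (x, Y ω) ∈ A} ≤ δ) : μ {ω | (X ω, Y ω) ∈ A} ≤ δ := by
  have h1 := (indepFun_iff_map_prod_eq_prod_map_map hX.aemeasurable hY.aemeasurable).1 hXY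
  have hX' := Measure.isProbabilityMeasure_map (μ := μ) hX.aemeasurable
  have hY' := Measure.isProbabilityMeasure_map (μ := μ) hY.aemeasurable
  calc μ {ω | (X ω, Y ω) ∈ A} = μ.map (fun ω => (X ω, Y ω)) A :=
        (Measure.map_apply (hX.prodMk hY) hA).symm
    _ = ∫⁻ x, μ.map Y (Prod.mk x ⁻¹' A) ∂(μ.map X) := by
        rw [h1, Measure.prod_apply hA]
    _ ≤ ∫⁻ _, δ ∂(μ.map X) := by
        refine lintegral_mono fun x => ?_
        rw [Measure.map_apply hY (measurable_prodMk_left hA)]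
        exact h x
    _ = δ := by simp

/-- One of the real and imaginary parts has size at least `t / √2`; the four units reduce a complex
tail to one-sided real tails. -/
theorem exists_unit_le_re {z : ℂ} {t : ℝ} (ht : 0 ≤ t) (hz : t < ‖z‖) :
    ∃ u ∈ ({1, -1, Complex.I, -Complex.I} : Finset ℂ), t / Real.sqrt 2 ≤ (u * z).re := by
  by_contra! hcon
  have h1 := hcon 1 (by simp)
  have h2 := hcon (-1) (by simp)
  have h3 := hcon Complex.I (by simp)
  have h4 := hcon (-Complex.I) (by simp)
  simp only [one_mul, neg_mul, Complex.neg_re, Complex.I_mul_re, neg_neg] at h1 h2 h3 h4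
  have hs : (t / Real.sqrt 2) ^ 2 = t ^ 2 / 2 := by
    rw [div_pow, Real.sq_sqrt (by norm_num)]
  have hr : z.re ^ 2 ≤ (t / Real.sqrt 2) ^ 2 := sq_le_sq' (by linarith) h1.le
  have hi : z.im ^ 2 ≤ (t / Real.sqrt 2) ^ 2 := sq_le_sq' (by linarith) h4.le
  have hn : ‖z‖ ^ 2 = z.re ^ 2 + z.im ^ 2 := by
    rw [← Complex.normSq_eq_norm_sq, Complex.normSq_apply]
    ring
  have : ‖z‖ ^ 2 ≤ t ^ 2 := by
    rw [hn]
    linarith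
  exact absurd (abs_le_of_sq_le_sq this ht) (by simpa using hz)

namespace IsSteinhaus

variable {Ω : Type*} [MeasurableSpace Ω] {μ : Measure Ω} {f : ℕ → Ω → ℂ}

theorem hasSubgaussianMGF_re [IsProbabilityMeasure μ] (hf : IsSteinhaus μ f) (p : Nat.Primes)
    (c : ℂ) : HasSubgaussianMGF (fun ω => (c * f p ω).re) (‖c‖₊ ^ 2) μ := by
  have hm := hf.measurable_prime p
  have hb : ∀ᵐ ω ∂μ, ‖f p ω‖ = 1 := by
    filter_upwards [hf.ae_norm_eq_one] with ω hω
    exact hω p p.2.ne_zero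
  have hint : Integrable (f p) μ :=
    Integrable.of_bound hm.aestronglyMeasurable 1 (hb.mono fun ω h => h.le)
  have h0 : ∫ ω, f p ω ∂μ = 0 := by
    have := hf.integral_pow_mul_conj_pow p 1 0
    simpa using this
  have h1 : ∫ ω, (c * f p ω).re ∂μ = 0 := by
    have := integral_re (hint.const_mul c)
    simp only [RCLike.re_to_complex] at this
    rw [this, integral_const_mul, h0, mul_zero, Complex.zero_re]
  have h2 : ∀ᵐ ω ∂μ, (c * f p ω).re ∈ Set.Icc (-‖c‖) ‖c‖ := by
    filter_upwards [hb] with ω hω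
    have := Complex.abs_re_le_norm (c * f p ω)
    rw [norm_mul, hω, mul_one] at this
    exact abs_le.1 this
  have h3 := hasSubgaussianMGF_of_mem_Icc_of_integral_eq_zero
    (Complex.measurable_re.comp (hm.const_mul c)).aemeasurable h2 h1
  refine h3.of_le (le_of_eq ?_)
  congr 1
  ext
  simp only [NNReal.coe_div, coe_nnnorm, NNReal.coe_ofNat, Real.norm_eq_abs]
  rw [sub_neg_eq_add, abs_of_nonneg (by positivity)]
  ring

/-- **Hoeffding's inequality** for linear combinations of the values of `f` at primes. -/
theorem measureReal_lt_norm_sum_le [IsProbabilityMeasure μ] (hf : IsSteinhaus μ f)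
    (S : Finset Nat.Primes) (c : Nat.Primes → ℂ) {V t : ℝ} (hV : ∑ p ∈ S, ‖c p‖ ^ 2 ≤ V)
    (ht : 0 ≤ t) :
    μ.real {ω | t < ‖∑ p ∈ S, c p * f p ω‖} ≤ 4 * Real.exp (-t ^ 2 / (4 * V)) := by
  have hV0 : 0 ≤ V := (Finset.sum_nonneg fun _ _ => by positivity).trans hV
  have key : ∀ u ∈ ({1, -1, Complex.I, -Complex.I} : Finset ℂ),
      μ.real {ω | t / Real.sqrt 2 ≤ (u * ∑ p ∈ S, c p * f p ω).re} ≤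
        Real.exp (-t ^ 2 / (4 * V)) := by
    intro u hu
    have hu1 : ‖u‖ = 1 := by
      simp only [Finset.mem_insert, Finset.mem_singleton] at hu
      rcases hu with rfl | rfl | rfl | rfl <;> simp
    have hind : iIndepFun (fun (p : Nat.Primes) ω => (u * c p * f p ω).re) μ :=
      hf.indep_prime.comp (fun p z => (u * c p * z).re) fun p =>
        (by fun_prop : Continuous fun z : ℂ => (u * c p * z).re).measurable
    have hsum := HasSubgaussianMGF.sum_of_iIndepFun hind (s := S)
      fun p _ => hf.hasSubgaussianMGF_re p (u * c p)
    have hle : ∑ p ∈ S, ‖u * c p‖₊ ^ 2 ≤ V.toNNReal := by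
      rw [← NNReal.coe_le_coe, Real.coe_toNNReal _ hV0]
      push_cast
      simpa [hu1] using hV
    have h := (hsum.of_le hle).measure_ge_le (div_nonneg ht (Real.sqrt_nonneg 2))
    rw [Real.coe_toNNReal _ hV0, div_pow, Real.sq_sqrt (by norm_num)] at h
    -- The loss `t / √2` in passing to real parts turns the exponent `-t² / (2 V)` into `-t² / (4
    -- V)`.
    have h4 : -(t ^ 2 / 2) / (2 * V) = -t ^ 2 / (4 * V) := by
      rw [← neg_div, div_div]
      ring_nf
    rw [h4] at h
    convert h using 4 with ω
    rw [Finset.mul_sum, Complex.re_sum]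
    simp only [mul_assoc]
  have hsub : {ω | t < ‖∑ p ∈ S, c p * f p ω‖} ⊆
      ⋃ u ∈ ({1, -1, Complex.I, -Complex.I} : Finset ℂ),
        {ω | t / Real.sqrt 2 ≤ (u * ∑ p ∈ S, c p * f p ω).re} := by
    intro ω hω
    obtain ⟨u, hu, h⟩ := exists_unit_le_re ht hω
    exact Set.mem_biUnion hu h
  refine (measureReal_mono hsub (measure_ne_top _ _)).trans ((measureReal_biUnion_finset_le _ _).trans ?_)
  refine (Finset.sum_le_sum key).trans ?_
  rw [Finset.sum_const, nsmul_eq_mul]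
  refine mul_le_mul_of_nonneg_right ?_ (Real.exp_pos _).le
  exact_mod_cast Finset.card_le_four

end IsSteinhaus

/-- The primes below `T`. -/
def smallPrimes (T : ℕ) : Finset Nat.Primes := (Finset.range T).subtype Nat.Prime

/-- The primes in `[T, N]`. -/
def largePrimes (T N : ℕ) : Finset Nat.Primes := (Finset.Icc T N).subtype Nat.Prime

theorem mem_smallPrimes {T : ℕ} {p : Nat.Primes} : p ∈ smallPrimes T ↔ (p : ℕ) < T := by
  rw [smallPrimes]
  exact Finset.mem_subtype.trans Finset.mem_range

theorem mem_largePrimes {T N : ℕ} {p : Nat.Primes} :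
    p ∈ largePrimes T N ↔ T ≤ (p : ℕ) ∧ (p : ℕ) ≤ N := by
  rw [largePrimes]
  exact Finset.mem_subtype.trans Finset.mem_Icc

theorem disjoint_smallPrimes_largePrimes (T N : ℕ) :
    Disjoint (smallPrimes T) (largePrimes T N) := by
  rw [Finset.disjoint_left]
  intro p h1 h2
  rw [mem_smallPrimes] at h1
  rw [mem_largePrimes] at h2
  omega

open Classical in
/-- The completely multiplicative function with prescribed values at the primes of `S`, and with
value `1` at the other primes. -/
noncomputable def multExtend {S : Finset Nat.Primes} (x : S → ℂ) (n : ℕ) : ℂ :=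
  ∏ p ∈ n.primeFactors,
    (if h : ∃ hp : p.Prime, (⟨p, hp⟩ : Nat.Primes) ∈ S then x ⟨⟨p, h.1⟩, h.2⟩ else 1) ^
      padicValNat p n

theorem measurable_multExtend {S : Finset Nat.Primes} (n : ℕ) :
    Measurable (fun x : S → ℂ => multExtend x n) := by
  unfold multExtend
  refine Finset.measurable_fun_prod _ fun p _ => Measurable.pow_const ?_ _
  split_ifs with h
  · exact measurable_pi_apply _
  · exact measurable_const

theorem measurable_primeCoeff_multExtend {S : Finset Nat.Primes} (N n : ℕ) (θ : ℝ) :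
    Measurable (fun x : S → ℂ => primeCoeff (multExtend x) N n θ) := by
  unfold primeCoeff
  exact Finset.measurable_fun_sum _ fun m _ => (measurable_multExtend m).mul_const _

theorem primeCoeff_congr {g g' : ℕ → ℂ} {N T n : ℕ} (hT : 1 ≤ T) (hn : T ≤ n)
    (h : ∀ m ∈ Finset.Icc 1 (N / T), g m = g' m) (θ : ℝ) :
    primeCoeff g N n θ = primeCoeff g' N n θ := by
  refine Finset.sum_congr rfl fun m hm => ?_
  rw [h m]
  rw [Finset.mem_Icc] at hm ⊢
  exact ⟨hm.1, hm.2.trans (Nat.div_le_div_left hn hT)⟩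

namespace IsSteinhaus

variable {Ω : Type*} [MeasurableSpace Ω] {μ : Measure Ω} {f : ℕ → Ω → ℂ}

/-- Every prime factor of `n < T` is a small prime, so the default value `1` is never used. -/
theorem multExtend_eq (hf : IsSteinhaus μ f) {T n : ℕ} (hn : n ≠ 0) (hnT : n < T) (ω : Ω) :
    multExtend (fun p : smallPrimes T => f p ω) n = f n ω := by
  rw [hf.eq_prod n hn, multExtend]
  refine Finset.prod_congr rfl fun p hp => ?_
  have hpp := Nat.prime_of_mem_primeFactors hp
  rw [dif_pos ⟨hpp, mem_smallPrimes.2 ((Nat.le_of_mem_primeFactors hp).trans_lt hnT)⟩]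

/-- On the event that the conditional variance is at most `V` on `G`, the exponential sum over
large primes is at most `t` on `G`, up to an event of small probability. -/
theorem measureReal_and_exists_lt_norm_sum_le [IsProbabilityMeasure μ] (hf : IsSteinhaus μ f)
    {N T : ℕ} (hT : 1 ≤ T) (hNT : N / T < T) (G : Finset ℝ) {V t : ℝ} (ht : 0 ≤ t) :
    μ.real {ω | (∀ θ ∈ G, ∑ n ∈ Finset.Icc T N, ‖primeCoeff (fun n => f n ω) N n θ‖ ^ 2 ≤ V) ∧
      ∃ θ ∈ G, t < ‖∑ p ∈ largePrimes T N, primeCoeff (fun n => f n ω) N p θ * f p ω‖} ≤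
      G.card * (4 * Real.exp (-t ^ 2 / (4 * V))) := by
  set S := smallPrimes T
  set L := largePrimes T N
  have hind := hf.indep_prime.indepFun_finset S L (disjoint_smallPrimes_largePrimes T N)
    hf.measurable_prime
  let A : Set ((S → ℂ) × (L → ℂ)) :=
    {z | (∀ θ ∈ G, ∑ n ∈ Finset.Icc T N, ‖primeCoeff (multExtend z.1) N n θ‖ ^ 2 ≤ V) ∧
      ∃ θ ∈ G, t < ‖∑ p : L, primeCoeff (multExtend z.1) N p θ * z.2 p‖}
  have hmeas : ∀ (n : ℕ) (θ : ℝ), Measurable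
      (fun z : (S → ℂ) × (L → ℂ) => primeCoeff (multExtend z.1) N n θ) := fun n θ =>
    (measurable_primeCoeff_multExtend N n θ).comp measurable_fst
  have hA : MeasurableSet A := by
    refine MeasurableSet.inter ?_ ?_
    · have : {z : (S → ℂ) × (L → ℂ) | ∀ θ ∈ G, ∑ n ∈ Finset.Icc T N,
          ‖primeCoeff (multExtend z.1) N n θ‖ ^ 2 ≤ V} = ⋂ θ ∈ G,
          {z | ∑ n ∈ Finset.Icc T N, ‖primeCoeff (multExtend z.1) N n θ‖ ^ 2 ≤ V} := by
        ext z
        simp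
      change MeasurableSet {z : (S → ℂ) × (L → ℂ) | ∀ θ ∈ G, ∑ n ∈ Finset.Icc T N,
          ‖primeCoeff (multExtend z.1) N n θ‖ ^ 2 ≤ V}
      rw [this]
      refine Finset.measurableSet_biInter _ fun θ _ => measurableSet_le ?_ measurable_const
      exact Finset.measurable_fun_sum _ fun n _ => (hmeas n θ).norm.pow_const 2
    · have : {z : (S → ℂ) × (L → ℂ) | ∃ θ ∈ G,
          t < ‖∑ p : L, primeCoeff (multExtend z.1) N p θ * z.2 p‖} = ⋃ θ ∈ G,
          {z | t < ‖∑ p : L, primeCoeff (multExtend z.1) N p θ * z.2 p‖} := by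
        ext z
        simp
      change MeasurableSet {z : (S → ℂ) × (L → ℂ) | ∃ θ ∈ G,
          t < ‖∑ p : L, primeCoeff (multExtend z.1) N p θ * z.2 p‖}
      rw [this]
      refine Finset.measurableSet_biUnion _ fun θ _ => measurableSet_lt measurable_const ?_
      refine Measurable.norm (Finset.measurable_fun_sum _ fun p _ => (hmeas p θ).mul ?_)
      exact (measurable_pi_apply p).comp measurable_snd
  have hcond : ∀ x : S → ℂ, μ {ω | (x, fun p : L => f p ω) ∈ A} ≤
      ENNReal.ofReal (G.card * (4 * Real.exp (-t ^ 2 / (4 * V)))) := by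
    intro x
    rw [← ofReal_measureReal]
    refine ENNReal.ofReal_le_ofReal ?_
    -- The variance condition depends only on the frozen coordinates. If it holds, Hoeffding and a
    -- union bound over `G` apply; otherwise the section of `A` is empty.
    by_cases hx : ∀ θ ∈ G, ∑ n ∈ Finset.Icc T N, ‖primeCoeff (multExtend x) N n θ‖ ^ 2 ≤ V
    · have hsub : {ω | (x, fun p : L => f p ω) ∈ A} ⊆ ⋃ θ ∈ G,
          {ω | t < ‖∑ p ∈ L, primeCoeff (multExtend x) N p θ * f p ω‖} := by
        rintro ω ⟨-, θ, hθ, h⟩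
        refine Set.mem_biUnion hθ ?_
        have h' : ∑ p : L, primeCoeff (multExtend x) N p θ * f p ω =
            ∑ p ∈ L, primeCoeff (multExtend x) N p θ * f p ω :=
          Finset.sum_coe_sort L fun p : Nat.Primes => primeCoeff (multExtend x) N p θ * f p ω
        rw [Set.mem_ofPred_eq, ← h']
        exact h
      refine (measureReal_mono hsub (measure_ne_top _ _)).trans ((measureReal_biUnion_finset_le _ _).trans ?_)
      rw [← nsmul_eq_mul]
      refine Finset.sum_le_card_nsmul _ _ _ fun θ hθ => ?_
      refine hf.measureReal_lt_norm_sum_le L (fun p => primeCoeff (multExtend x) N p θ) ?_ ht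
      refine le_trans ?_ (hx θ hθ)
      -- Enlarges the variance from primes to all integers in `[T, N]`; the prime `2` is a dummy
      -- value of the inverse at composites.
      refine sum_le_sum_of_leftInverse (fun p : Nat.Primes => (p : ℕ))
        (fun n => if h : n.Prime then ⟨n, h⟩ else ⟨2, Nat.prime_two⟩) ?_ ?_ ?_ ?_
      · intro p hp
        exact Finset.mem_Icc.2 (mem_largePrimes.1 hp)
      · intro p _
        exact dif_pos p.2
      · intro p _
        exact le_rfl
      · intro n _
        positivity
    · have : {ω | (x, fun p : L => f p ω) ∈ A} = ∅ := by
        ext ω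
        simp only [Set.mem_ofPred_eq, Set.mem_empty_iff_false, iff_false]
        exact fun h => hx h.1
      rw [this, measureReal_empty]
      positivity
  have hmain := hind.measure_prodMk_mem_le
    (measurable_pi_lambda _ fun p => hf.measurable_prime p)
    (measurable_pi_lambda _ fun p => hf.measurable_prime p) hA hcond
  refine ENNReal.toReal_le_of_le_ofReal (by positivity) (le_trans (measure_mono ?_) hmain)
  rintro ω ⟨h1, θ, hθ, h2⟩
  have hext : ∀ (n : ℕ) (θ : ℝ), T ≤ n → primeCoeff (multExtend (fun p : S => f p ω)) N n θ =
      primeCoeff (fun n => f n ω) N n θ := by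
    intro n θ hn
    refine primeCoeff_congr hT hn (fun m hm => ?_) θ
    rw [Finset.mem_Icc] at hm
    exact hf.multExtend_eq (by omega) (by omega) ω
  refine ⟨fun θ hθ => ?_, θ, hθ, ?_⟩
  · refine le_trans (le_of_eq (Finset.sum_congr rfl fun n hn => ?_)) (h1 θ hθ)
    rw [hext n θ (Finset.mem_Icc.1 hn).1]
  · refine lt_of_lt_of_eq h2 (congrArg _ ?_)
    rw [← Finset.sum_coe_sort]
    refine Finset.sum_congr rfl fun p _ => ?_
    rw [← hext p θ (mem_largePrimes.1 p.2).1]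

end IsSteinhaus

/-! ### Factoring out the largest prime factor -/

theorem largestPrimeFactor_mul {p m : ℕ} (hp : p.Prime) (hm : m ≠ 0) (hmp : m ≤ p) :
    largestPrimeFactor (p * m) = p := by
  unfold largestPrimeFactor
  apply le_antisymm
  · refine Finset.sup_le fun r hr => ?_
    rw [Nat.primeFactors_mul hp.ne_zero hm, Finset.mem_union] at hr
    rcases hr with hr | hr
    · exact Nat.le_of_mem_primeFactors hr
    · exact (Nat.le_of_mem_primeFactors hr).trans hmp
  · exact Finset.le_sup (f := id) (Nat.mem_primeFactors.2
      ⟨hp, dvd_mul_right _ _, mul_ne_zero hp.ne_zero hm⟩)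

theorem largestPrimeFactor_mem_primeFactors {n : ℕ} (h : 1 ≤ largestPrimeFactor n) :
    largestPrimeFactor n ∈ n.primeFactors := by
  unfold largestPrimeFactor at h ⊢
  have hne : n.primeFactors.Nonempty := by
    rw [Finset.nonempty_iff_ne_empty]
    intro h0
    simp [h0] at h
  obtain ⟨p, hp, hp'⟩ := Finset.exists_mem_eq_sup n.primeFactors hne id
  rw [hp']
  exact hp

/-- For `p ≥ T` the cofactor satisfies `m ≤ N / T < T ≤ p`, so `p` is the largest prime factor of `p
* m` and is recovered from the product. As prime factors are integers, the cutoff `N ^ 0.8` may be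
replaced by its ceiling. -/
theorem IsSteinhaus.partialSum_eq {Ω : Type*} [MeasurableSpace Ω] {μ : Measure Ω}
    {f : ℕ → Ω → ℂ} (hf : IsSteinhaus μ f) {N T : ℕ} (hTN : T = ⌈(N : ℝ) ^ (0.8 : ℝ)⌉₊)
    (hT : 1 ≤ T) (hNT : N / T < T) (ω : Ω) (θ : ℝ) :
    partialSum (fun n => f n ω) N θ =
      ∑ p ∈ largePrimes T N, primeCoeff (fun n => f n ω) N p θ * f p ω := by
  simp only [primeCoeff, Finset.sum_mul, partialSum]
  rw [Finset.sum_sigma']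
  have hmem : ∀ x ∈ (largePrimes T N).sigma fun p => Finset.Icc 1 (N / p),
      T ≤ (x.1 : ℕ) ∧ 1 ≤ x.2 ∧ x.2 < x.1 ∧ (x.1 : ℕ) * x.2 ≤ N := by
    rintro ⟨p, m⟩ hx
    rw [Finset.mem_sigma, mem_largePrimes, Finset.mem_Icc] at hx
    obtain ⟨⟨h1, h2⟩, h3, h4⟩ := hx
    dsimp only at h1 h2 h3 h4 ⊢
    have h5 : N / p ≤ N / T := Nat.div_le_div_left h1 hT
    refine ⟨h1, h3, by omega, ?_⟩
    rw [mul_comm]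
    exact (Nat.le_div_iff_mul_le (by omega)).1 h4
  symm
  refine Finset.sum_bij (fun x _ => (x.1 : ℕ) * x.2) ?_ ?_ ?_ ?_
  · intro x hx
    obtain ⟨h1, h2, h3, h4⟩ := hmem x hx
    rw [Finset.mem_filter, Finset.mem_Icc, largestPrimeFactor_mul x.1.2 (by omega) h3.le,
      ← Nat.ceil_le, ← hTN]
    exact ⟨⟨Nat.mul_pos (by omega) h2, h4⟩, h1⟩
  · rintro ⟨p, m⟩ hx ⟨p', m'⟩ hx' h
    obtain ⟨h1, h2, h3, h4⟩ := hmem _ hx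
    obtain ⟨h1', h2', h3', h4'⟩ := hmem _ hx'
    dsimp only at *
    have hp : p = p' := by
      apply Subtype.ext
      rw [← largestPrimeFactor_mul p.2 (by omega) h3.le, h,
        largestPrimeFactor_mul p'.2 (by omega) h3'.le]
    subst hp
    rw [Nat.eq_of_mul_eq_mul_left p.2.pos h]
  · intro n hn
    rw [Finset.mem_filter, Finset.mem_Icc, ← Nat.ceil_le, ← hTN] at hn
    obtain ⟨⟨h1, h2⟩, h3⟩ := hn
    have hp := largestPrimeFactor_mem_primeFactors (hT.trans h3)
    have hpp := Nat.prime_of_mem_primeFactors hp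
    have hdvd := Nat.dvd_of_mem_primeFactors hp
    have hle := Nat.le_of_mem_primeFactors hp
    refine ⟨⟨⟨largestPrimeFactor n, hpp⟩, n / largestPrimeFactor n⟩, ?_,
      Nat.mul_div_cancel' hdvd⟩
    rw [Finset.mem_sigma, mem_largePrimes, Finset.mem_Icc]
    exact ⟨⟨h3, hle.trans h2⟩, Nat.div_pos hle hpp.pos, Nat.div_le_div_right h2⟩
  · intro x hx
    obtain ⟨h1, h2, h3, h4⟩ := hmem x hx
    rw [hf.map_mul x.1.2.ne_zero (by omega)]
    ring

/-! ### The sampling grid -/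

/-- The admissible pairs of a denominator and an offset, for sampling near rationals. -/
noncomputable def gridIndex (N R : ℕ) : Finset (ℕ × ℤ) :=
  (Finset.Icc 1 (4 * R) ×ˢ Finset.Icc (-(16 * N : ℕ) : ℤ) (16 * N : ℕ)).filter
    fun i => |(i.2 : ℝ) / (16 * N)| * R ≤ 1 / (2 * i.1)

open Classical in
/-- The sampling grid: points near rationals `a / q` with `q ≤ 4 R`, at multiples of `1 / (16 N)`
from them. -/
noncomputable def grid (N R : ℕ) : Finset ℝ :=
  ((gridIndex N R ×ˢ Finset.Icc (-(4 * R : ℕ) : ℤ) (8 * R : ℕ)).filter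
    fun x => IsCoprime x.2 (x.1.1 : ℤ)).image fun x => (x.2 : ℝ) / x.1.1 + x.1.2 / (16 * N)

theorem mem_grid {N R : ℕ} {θ : ℝ} (h : θ ∈ grid N R) : ∃ (q : ℕ) (j a : ℤ),
    (q, j) ∈ gridIndex N R ∧ IsCoprime a (q : ℤ) ∧ θ = a / q + j / (16 * N) := by
  classical
  rw [grid, Finset.mem_image] at h
  obtain ⟨⟨⟨q, j⟩, a⟩, hx, rfl⟩ := h
  rw [Finset.mem_filter, Finset.mem_product] at hx
  exact ⟨q, j, a, hx.1.1, hx.2, rfl⟩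

theorem card_grid_le {N R : ℕ} (hN : 1716 ≤ N) (hRN : R ≤ N) : (grid N R).card ≤ N ^ 4 := by
  classical
  have h1 : (gridIndex N R).card ≤ 4 * R * (32 * N + 1) := by
    refine (Finset.card_filter_le _ _).trans (le_of_eq ?_)
    rw [Finset.card_product, Nat.card_Icc, Int.card_Icc]
    congr 1
    omega
  have h2 : (grid N R).card ≤ (4 * R * (32 * N + 1)) * (12 * R + 1) := by
    refine Finset.card_image_le.trans ((Finset.card_filter_le _ _).trans ?_)
    rw [Finset.card_product, Int.card_Icc]
    refine Nat.mul_le_mul h1 ?_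
    omega
  calc _ ≤ (4 * R * (32 * N + 1)) * (12 * R + 1) := h2
    -- The product `4 * 33 * 13 = 1716` is the source of the threshold on `N`.
    _ ≤ (4 * N * (33 * N)) * (13 * N) := by gcongr <;> omega
    _ = 1716 * N ^ 3 := by ring
    _ ≤ N * N ^ 3 := Nat.mul_le_mul_right _ hN
    _ = N ^ 4 := by ring

/-- Dirichlet's theorem with denominators up to `4 R` gives `|θ - r| R ≤ 1 / (4 q)`. Rounding `θ -
r` to a multiple of `1 / (16 N)` costs at most `1 / (32 N)`, and `R² ≤ N` keeps the total within the
`1 / (2 q)` allowed by `gridIndex`. -/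
theorem exists_mem_grid {N R : ℕ} (hR : 1 ≤ R) (hRN : R ^ 2 ≤ N) {θ : ℝ}
    (hθ : θ ∈ Set.Icc (0 : ℝ) 1) : ∃ θ' ∈ grid N R, |θ' - θ| * (32 * N) ≤ 1 := by
  classical
  obtain ⟨r, hr, hden⟩ := Real.exists_rat_abs_sub_le_and_den_le θ (n := 4 * R) (by omega)
  have hN : 1 ≤ N := (Nat.one_le_pow _ _ hR).trans hRN
  have hN0 : (0 : ℝ) < N := by exact_mod_cast hN
  have hR0 : (1 : ℝ) ≤ R := by exact_mod_cast hR
  have hq : 1 ≤ r.den := r.den_pos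
  have hq0 : (1 : ℝ) ≤ r.den := by exact_mod_cast hq
  have hqR : (r.den : ℝ) ≤ 4 * R := by exact_mod_cast hden
  have hRN' : (R : ℝ) ^ 2 ≤ N := by exact_mod_cast hRN
  have hrq : (r : ℝ) = r.num / r.den := Rat.cast_def r
  set j : ℤ := round (16 * N * (θ - r))
  have hj : |(j : ℝ) / (16 * N) - (θ - r)| ≤ 1 / (32 * N) := by
    have h := abs_sub_round (16 * N * (θ - r))
    have h2 : (j : ℝ) / (16 * N) - (θ - r) = -(16 * N * (θ - r) - j) / (16 * N) := by
      field_simp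
      ring
    rw [h2, abs_div, abs_neg, abs_of_pos (by positivity : (0 : ℝ) < 16 * N),
      div_le_div_iff₀ (by positivity) (by positivity)]
    nlinarith
  have hr' : |θ - r| * R ≤ 1 / (4 * r.den) := by
    calc |θ - r| * R ≤ 1 / (((4 * R : ℕ) + 1) * r.den) * R :=
          mul_le_mul_of_nonneg_right hr (by positivity)
      _ ≤ _ := by
        rw [div_mul_eq_mul_div, div_le_div_iff₀ (by positivity) (by positivity)]
        push_cast
        nlinarith
  have hj1 : |(j : ℝ) / (16 * N)| * R ≤ 1 / (2 * r.den) := by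
    have h1 : |(j : ℝ) / (16 * N)| ≤ |θ - r| + 1 / (32 * N) := by
      have := abs_add_le ((j : ℝ) / (16 * N) - (θ - r)) (θ - r)
      rw [sub_add_cancel] at this
      linarith
    have h2 : 1 / (32 * (N : ℝ)) * R ≤ 1 / (4 * r.den) := by
      rw [div_mul_eq_mul_div, div_le_div_iff₀ (by positivity) (by positivity)]
      nlinarith
    have h3 : 1 / (2 * (r.den : ℝ)) = 1 / (4 * r.den) + 1 / (4 * r.den) := by
      field_simp
      norm_num
    have h4 := mul_le_mul_of_nonneg_right h1 (by positivity : (0 : ℝ) ≤ R)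
    rw [add_mul] at h4
    linarith
  have hj2 : |j| ≤ (16 * N : ℕ) := by
    have h1 : 1 / (2 * (r.den : ℝ)) ≤ 1 := by
      rw [div_le_one (by positivity)]
      linarith
    have h2 : |(j : ℝ) / (16 * N)| ≤ 1 := by
      nlinarith [abs_nonneg ((j : ℝ) / (16 * N))]
    rw [abs_div, abs_of_pos (by positivity : (0 : ℝ) < 16 * N), div_le_one (by positivity)] at h2
    exact_mod_cast h2
  have hr1 : |θ - r| ≤ 1 := by
    have h1 : 1 / (4 * (r.den : ℝ)) ≤ 1 := by
      rw [div_le_one (by positivity)]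
      linarith
    nlinarith [abs_nonneg (θ - r)]
  rw [abs_le] at hr1
  have ha1 : -(r.den : ℤ) ≤ r.num := by
    have : -(r.den : ℝ) ≤ r.num := by
      have h : -1 ≤ (r.num : ℝ) / r.den := by
        rw [← hrq]
        linarith [hθ.1]
      rw [le_div_iff₀ (by positivity)] at h
      linarith
    exact_mod_cast this
  have ha2 : r.num ≤ 2 * (r.den : ℤ) := by
    have : (r.num : ℝ) ≤ 2 * r.den := by
      have h : (r.num : ℝ) / r.den ≤ 2 := by
        rw [← hrq]
        linarith [hθ.2]
      rwa [div_le_iff₀ (by positivity)] at h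
    exact_mod_cast this
  refine ⟨(r.num : ℝ) / r.den + j / (16 * N), ?_, ?_⟩
  · rw [grid, Finset.mem_image]
    refine ⟨((r.den, j), r.num), ?_, rfl⟩
    rw [Finset.mem_filter, Finset.mem_product, gridIndex, Finset.mem_filter, Finset.mem_product]
    simp only [Finset.mem_Icc]
    rw [abs_le] at hj2
    refine ⟨⟨⟨⟨⟨hq, hden⟩, hj2⟩, hj1⟩, by omega, by omega⟩, ?_⟩
    exact Int.isCoprime_iff_nat_coprime.2 (by simpa using r.reduced)
  · rw [← hrq, show (r : ℝ) + j / (16 * N) - θ = j / (16 * N) - (θ - r) by ring]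
    rwa [le_div_iff₀ (by positivity)] at hj

/-! ### The main estimate -/

theorem ceil_rpow_facts {N : ℕ} (hN : 2 ≤ N) {T : ℕ} (hT : T = ⌈(N : ℝ) ^ (0.8 : ℝ)⌉₊) :
    1 ≤ T ∧ 1 ≤ N / T ∧ N / T < T ∧ (N / T) ^ 5 ≤ N := by
  have hN1 : (1 : ℝ) < N := by exact_mod_cast hN
  have hN0 : (0 : ℝ) < N := by linarith
  have hTle : (N : ℝ) ^ (0.8 : ℝ) ≤ T := hT ▸ Nat.le_ceil _
  have hpos : (0 : ℝ) < (N : ℝ) ^ (0.8 : ℝ) := Real.rpow_pos_of_pos hN0 _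
  have hT1 : 1 ≤ T := by
    have : (0 : ℝ) < T := hpos.trans_le hTle
    exact_mod_cast this
  have hTN : T ≤ N := by
    rw [hT]
    refine Nat.ceil_le.2 ?_
    calc (N : ℝ) ^ (0.8 : ℝ) ≤ (N : ℝ) ^ (1 : ℝ) :=
          Real.rpow_le_rpow_of_exponent_le hN1.le (by norm_num)
      _ = N := Real.rpow_one _
  have hR : ((N / T : ℕ) : ℝ) ≤ (N : ℝ) ^ (0.2 : ℝ) := by
    calc ((N / T : ℕ) : ℝ) ≤ N / T := Nat.cast_div_le
      _ ≤ N / (N : ℝ) ^ (0.8 : ℝ) := div_le_div_of_nonneg_left hN0.le hpos hTle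
      _ = (N : ℝ) ^ (1 - 0.8 : ℝ) := by rw [Real.rpow_sub hN0, Real.rpow_one]
      _ = (N : ℝ) ^ (0.2 : ℝ) := by norm_num
  refine ⟨hT1, Nat.div_pos hTN hT1, ?_, ?_⟩
  · have : ((N / T : ℕ) : ℝ) < T :=
      (hR.trans_lt (Real.rpow_lt_rpow_of_exponent_lt hN1 (by norm_num))).trans_le hTle
    exact_mod_cast this
  · have : ((N / T : ℕ) : ℝ) ^ 5 ≤ N := by
      calc ((N / T : ℕ) : ℝ) ^ 5 ≤ ((N : ℝ) ^ (0.2 : ℝ)) ^ 5 :=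
            pow_le_pow_left₀ (Nat.cast_nonneg _) hR 5
        _ = (N : ℝ) ^ ((0.2 : ℝ) * (5 : ℕ)) := by rw [Real.rpow_mul hN0.le, Real.rpow_natCast]
        _ = N := by norm_num
    exact_mod_cast this

theorem two_le_log {N : ℕ} (hN : 1716 ≤ N) : 2 ≤ Real.log N := by
  have hN' : (1716 : ℝ) ≤ N := by exact_mod_cast hN
  rw [Real.le_log_iff_exp_le (by linarith)]
  have h1 := Real.exp_one_lt_d9
  have h2 : Real.exp 2 = Real.exp 1 ^ 2 := by
    rw [← Real.exp_nat_mul]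
    norm_num
  rw [h2]
  nlinarith [Real.exp_pos 1]

theorem sum_norm_sq_primeCoeff_le_of_mem_grid {g : ℕ → ℂ} {N T : ℕ} (hN : 1716 ≤ N)
    (hT : 1 ≤ T) (hR : (N / T) ^ 5 ≤ N)
    (hg : ∀ m ∈ Finset.Icc 1 (N / T), ‖g m‖ = 1) {W : ℝ}
    (hW : ∀ i ∈ gridIndex N (N / T), ‖offDiagonal g N T i.1 i.2‖ ≤ W) {θ : ℝ}
    (hθ : θ ∈ grid N (N / T)) :
    ∑ n ∈ Finset.Icc T N, ‖primeCoeff g N n θ‖ ^ 2 ≤ N * (2 + Real.log N) + W := by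
  obtain ⟨q, j, a, hi, ha, rfl⟩ := mem_grid hθ
  have hi' := hi
  rw [gridIndex, Finset.mem_filter, Finset.mem_product, Finset.mem_Icc] at hi'
  obtain ⟨⟨⟨hq1, hq⟩, -⟩, hj⟩ := hi'
  refine (sum_norm_sq_primeCoeff_le hT hq1 hg ha hj).trans ?_
  set R := N / T
  have h1 : (N : ℝ) * harmonicSum R ≤ N * (1 + Real.log N) := by
    refine mul_le_mul_of_nonneg_left ((harmonicSum_le R).trans ?_) (Nat.cast_nonneg _)
    rcases Nat.eq_zero_or_pos R with h0 | h0
    · rw [h0, Nat.cast_zero, Real.log_zero]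
      linarith [two_le_log hN]
    · have : Real.log R ≤ Real.log N :=
        Real.log_le_log (by exact_mod_cast h0) (by exact_mod_cast Nat.div_le_self N T)
      linarith
  -- As `q ≤ 4 R`, this reduces to `4 R³ ≤ N`: for `R ≥ 2` it follows from `4 R³ ≤ R^5`, and for
  -- smaller `R` from `N ≥ 1716`.
  have h2 : R ^ 2 * q ≤ N := by
    refine (Nat.mul_le_mul_left _ hq).trans ?_
    rcases Nat.lt_or_ge R 2 with h | h
    · interval_cases R <;> omega
    · calc R ^ 2 * (4 * R) = 2 ^ 2 * R ^ 3 := by ring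
        _ ≤ R ^ 2 * R ^ 3 := Nat.mul_le_mul_right _ (Nat.pow_le_pow_left h 2)
        _ = R ^ 5 := by ring
        _ ≤ N := hR
  have h2' : (R : ℝ) ^ 2 * q ≤ N := by exact_mod_cast h2
  have h3 := hW _ hi
  dsimp only at h3
  linarith

/-- The upper bound for the exceptional probability. -/
noncomputable def exceptionalBound (ε : ℝ) (N : ℕ) : ℝ :=
  8320 * Real.log N ^ (-(2 * ε)) + 4 * (N : ℝ)⁻¹

theorem tendsto_exceptionalBound {ε : ℝ} (hε : 0 < ε) :
    Filter.Tendsto (exceptionalBound ε) Filter.atTop (nhds 0) := by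
  have h1 : Filter.Tendsto (fun N : ℕ => Real.log N ^ (-(2 * ε))) Filter.atTop (nhds 0) :=
    (tendsto_rpow_neg_atTop (by positivity)).comp
      (Real.tendsto_log_atTop.comp tendsto_natCast_atTop_atTop)
  have h2 : Filter.Tendsto (fun N : ℕ => (N : ℝ)⁻¹) Filter.atTop (nhds 0) :=
    tendsto_inv_atTop_zero.comp tendsto_natCast_atTop_atTop
  have h := (h1.const_mul 8320).add (h2.const_mul 4)
  simp only [mul_zero, add_zero] at h
  exact h

theorem IsSteinhaus.one_sub_le_measureReal {Ω : Type*} [MeasurableSpace Ω] {μ : Measure Ω}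
    [IsProbabilityMeasure μ] {f : ℕ → Ω → ℂ} (hf : IsSteinhaus μ f) {ε : ℝ} (hε : 0 < ε)
    {N : ℕ} (hN : 1716 ≤ N) :
    1 - exceptionalBound ε N ≤ μ.real {ω | maxPartialSum (fun n => f n ω) N ≤
      13 * Real.log N ^ (7 / 4 + ε)} := by
  obtain ⟨T, hT⟩ : ∃ T, T = ⌈(N : ℝ) ^ (0.8 : ℝ)⌉₊ := ⟨_, rfl⟩
  obtain ⟨hT1, hR1, hRT, hR5⟩ := ceil_rpow_facts (by omega) hT
  have hN0 : (0 : ℝ) < N := by exact_mod_cast (by omega : 0 < N)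
  have hℓ := two_le_log hN
  set ℓ := Real.log N
  have hℓ0 : 0 < ℓ := by linarith
  set R := N / T
  -- `W` makes the Chebyshev bound `N² ℓ^5 / W²` equal to `ℓ ^ (-2 ε)`; `V` adds room for the
  -- diagonal and incongruent terms; `t` makes `t² / (4 V) = 5 ℓ`, so each tail is `4 N ^ (-5)`
  -- against at most `N ^ 4` grid points.
  set W : ℝ := N * ℓ ^ (5 / 2 + ε)
  set V : ℝ := 2 * W
  set t : ℝ := Real.sqrt (40 * N) * ℓ ^ (7 / 4 + ε / 2)
  have hW0 : 0 < W := by positivity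
  have ht0 : 0 ≤ t := by positivity
  set B₀ : Set Ω := {ω | ¬ ∀ n ≠ 0, ‖f n ω‖ = 1}
  set B₁ : Set Ω := {ω | ∃ i ∈ gridIndex N R, W < ‖offDiagonal (fun n => f n ω) N T i.1 i.2‖}
  set B₂ : Set Ω := {ω | (∀ θ ∈ grid N R,
    ∑ n ∈ Finset.Icc T N, ‖primeCoeff (fun n => f n ω) N n θ‖ ^ 2 ≤ V) ∧
    ∃ θ ∈ grid N R, t < ‖∑ p ∈ largePrimes T N, primeCoeff (fun n => f n ω) N p θ * f p ω‖}
  set E : Set Ω := {ω | maxPartialSum (fun n => f n ω) N ≤ 13 * ℓ ^ (7 / 4 + ε)}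
  have h0 : μ.real B₀ = 0 := by
    rw [measureReal_def, show μ B₀ = 0 from hf.ae_norm_eq_one, ENNReal.toReal_zero]
  have h1 : μ.real B₁ ≤ 8320 * ℓ ^ (-(2 * ε)) := by
    refine (hf.measureReal_exists_offDiagonal_le (I := gridIndex N R) (by omega) hT1 (4 * R) (16 * N)
      (Finset.filter_subset _ _) (fun i hi => ?_) hW0).trans ?_
    · rw [gridIndex, Finset.mem_filter, Finset.mem_product, Finset.mem_Icc] at hi
      refine hi.2.trans (one_div_le_one_div_of_le two_pos ?_)
      have : (1 : ℝ) ≤ i.1 := by exact_mod_cast hi.1.1.1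
      linarith
    · have hH : harmonicSum R ≤ 2 * ℓ := by
        have : Real.log R ≤ ℓ :=
          Real.log_le_log (by exact_mod_cast hR1) (by exact_mod_cast Nat.div_le_self N T)
        linarith [harmonicSum_le R]
      have hNW : (N / W) ^ 2 * ℓ ^ 5 = ℓ ^ (-(2 * ε)) := by
        have e1 : N / W = ℓ ^ (-(5 / 2 + ε)) := by
          rw [Real.rpow_neg hℓ0.le]
          simp only [W]
          field_simp
        rw [e1, ← Real.rpow_natCast, ← Real.rpow_natCast, ← Real.rpow_mul hℓ0.le,
          ← Real.rpow_add hℓ0]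
        congr 1
        push_cast
        ring
      -- The constant is `8320 = 260 * 2 ^ 5`.
      calc 260 * (N / W) ^ 2 * harmonicSum R ^ 5 ≤ 260 * (N / W) ^ 2 * (2 * ℓ) ^ 5 :=
            mul_le_mul_of_nonneg_left (pow_le_pow_left₀ (harmonicSum_nonneg R) hH 5)
              (by positivity)
        _ = 8320 * ((N / W) ^ 2 * ℓ ^ 5) := by ring
        _ = _ := by rw [hNW]
  have h2 : μ.real B₂ ≤ 4 * (N : ℝ)⁻¹ := by
    refine (hf.measureReal_and_exists_lt_norm_sum_le hT1 hRT (grid N R) ht0).trans ?_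
    have e1 : -t ^ 2 / (4 * V) = -(5 * ℓ) := by
      have e2 : (ℓ ^ (7 / 4 + ε / 2)) ^ 2 = ℓ ^ (5 / 2 + ε) * ℓ := by
        rw [← Real.rpow_natCast, ← Real.rpow_mul hℓ0.le, ← Real.rpow_add_one hℓ0.ne']
        congr 1
        push_cast
        ring
      have e3 : t ^ 2 = 40 * N * (ℓ ^ (5 / 2 + ε) * ℓ) := by
        simp only [t]
        rw [mul_pow, e2, Real.sq_sqrt (by positivity)]
      have hp : 0 < ℓ ^ (5 / 2 + ε) := by positivity
      rw [e3]
      simp only [V, W]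
      field_simp
      norm_num
    have e4 : Real.exp (-(5 * ℓ)) = ((N : ℝ) ^ 5)⁻¹ := by
      rw [Real.exp_neg, show 5 * ℓ = (5 : ℕ) * ℓ by norm_num, Real.exp_nat_mul,
        Real.exp_log hN0]
    rw [e1, e4]
    have hcard : ((grid N R).card : ℝ) ≤ (N : ℝ) ^ 4 := by
      exact_mod_cast card_grid_le hN (Nat.div_le_self N T)
    calc _ ≤ (N : ℝ) ^ 4 * (4 * ((N : ℝ) ^ 5)⁻¹) :=
          mul_le_mul_of_nonneg_right hcard (by positivity)
      _ = _ := by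
        field_simp
  -- Covering the whole space by `E` and the exceptional sets needs only subadditivity, so
  -- measurability of `E` is not required.
  have hcover : (Set.univ : Set Ω) ⊆ E ∪ (B₀ ∪ (B₁ ∪ B₂)) := by
    intro ω _
    by_contra hω
    simp only [Set.mem_union, not_or] at hω
    obtain ⟨hE, hB0, hB1, hB2⟩ := hω
    have hg : ∀ n ≠ 0, ‖f n ω‖ = 1 := not_not.1 hB0
    have hW : ∀ i ∈ gridIndex N R, ‖offDiagonal (fun n => f n ω) N T i.1 i.2‖ ≤ W := by
      intro i hi
      by_contra! h
      exact hB1 ⟨i, hi, h⟩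
    have hV : ∀ θ ∈ grid N R,
        ∑ n ∈ Finset.Icc T N, ‖primeCoeff (fun n => f n ω) N n θ‖ ^ 2 ≤ V := by
      intro θ hθ
      refine (sum_norm_sq_primeCoeff_le_of_mem_grid hN hT1 hR5
        (fun m hm => hg m (by rw [Finset.mem_Icc] at hm; omega)) hW hθ).trans ?_
      have hlog : 2 + ℓ ≤ ℓ ^ (5 / 2 + ε) := by
        calc 2 + ℓ ≤ ℓ ^ 2 := by nlinarith
          _ = ℓ ^ (2 : ℝ) := by norm_num
          _ ≤ ℓ ^ (5 / 2 + ε) :=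
            Real.rpow_le_rpow_of_exponent_le (by linarith) (by linarith)
      have := mul_le_mul_of_nonneg_left hlog hN0.le
      simp only [V]
      linarith
    have hS : ∀ θ ∈ grid N R, ‖partialSum (fun n => f n ω) N θ‖ ≤ t := by
      intro θ hθ
      by_contra! h
      rw [hf.partialSum_eq hT hT1 hRT] at h
      exact hB2 ⟨hV, θ, hθ, h⟩
    apply hE
    obtain ⟨θ₀, hθ₀, hmax⟩ := exists_forall_norm_le_two_mul (N := N)
      (s := (Finset.Icc 1 N).filter
        fun n => (N : ℝ) ^ (0.8 : ℝ) ≤ (largestPrimeFactor n : ℝ))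
      (fun n hn => (Finset.mem_Icc.1 (Finset.mem_filter.1 hn).1).2) (fun n => f n ω)
    obtain ⟨θ', hθ', hdist⟩ := exists_mem_grid (N := N) hR1
      ((Nat.pow_le_pow_right hR1 (by norm_num)).trans hR5) hθ₀
    have hbound : ∀ θ, ‖partialSum (fun n => f n ω) N θ‖ ≤ 2 * t := fun θ =>
      (hmax θ' hdist θ).trans (mul_le_mul_of_nonneg_left (hS θ' hθ') two_pos.le)
    have : Nonempty (Set.Icc (0 : ℝ) 1) := ⟨⟨0, by simp⟩⟩
    rw [Set.mem_ofPred_eq, maxPartialSum]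
    refine ciSup_le fun θ => ?_
    have hsq : Real.sqrt (40 * N) = Real.sqrt 40 * Real.sqrt N := Real.sqrt_mul (by norm_num) _
    have hsN : 0 < Real.sqrt N := Real.sqrt_pos.2 hN0
    have h40 : 2 * Real.sqrt 40 ≤ 13 := by
      have : Real.sqrt 40 ≤ 13 / 2 := Real.sqrt_le_iff.2 ⟨by norm_num, by norm_num⟩
      linarith
    calc 1 / Real.sqrt N * ‖partialSum (fun n => f n ω) N θ‖
        ≤ 1 / Real.sqrt N * (2 * t) := mul_le_mul_of_nonneg_left (hbound θ) (by positivity)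
      _ = 2 * Real.sqrt 40 * ℓ ^ (7 / 4 + ε / 2) := by
          simp only [t]
          rw [hsq]
          field_simp
      _ ≤ 13 * ℓ ^ (7 / 4 + ε) :=
          mul_le_mul h40 (Real.rpow_le_rpow_of_exponent_le (by linarith) (by linarith))
            (by positivity) (by norm_num)
  have hle : (1 : ℝ) ≤ μ.real E + (μ.real B₀ + (μ.real B₁ + μ.real B₂)) := by
    calc (1 : ℝ) = μ.real Set.univ := probReal_univ.symm
      _ ≤ μ.real (E ∪ (B₀ ∪ (B₁ ∪ B₂))) := measureReal_mono hcover
      _ ≤ _ := (measureReal_union_le _ _).trans (add_le_add_right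
          ((measureReal_union_le _ _).trans (add_le_add_right (measureReal_union_le _ _) _)) _)
  unfold exceptionalBound
  linarith

end RandomMult

theorem theorem1p2 :
    ∃ C : ℝ, 0 < C ∧ ∀ ε : ℝ, 0 < ε →
      ∃ δ : ℕ → ℝ, Filter.Tendsto δ Filter.atTop (nhds 0) ∧
        ∀ (Ω : Type*) [MeasurableSpace Ω] (μ : Measure Ω) [IsProbabilityMeasure μ]
          (f : ℕ → Ω → ℂ), RandomMult.IsSteinhaus μ f →
          ∀ N : ℕ, 1 - δ N ≤ μ.real {ω | RandomMult.maxPartialSum (fun n => f n ω) N ≤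
            C * Real.log N ^ (7 / 4 + ε)} := by
  -- The factor `2` from sampling and `√40` from `t` give `2 √40 ≤ 13`. Below the threshold `δ N =
  -- 1` makes the claim trivial.
  refine ⟨13, by norm_num, fun ε hε =>
    ⟨fun N => if 1716 ≤ N then RandomMult.exceptionalBound ε N else 1, ?_, ?_⟩⟩
  · refine (RandomMult.tendsto_exceptionalBound hε).congr' ?_
    filter_upwards [Filter.eventually_ge_atTop 1716] with N hN
    rw [if_pos hN]
  · intro Ω _ μ _ f hf N
    dsimp only
    split_ifs with hN
    · exact hf.one_sub_le_measureReal hε hN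
    · rw [sub_self]
      exact measureReal_nonneg
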